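/- Let $q\in L^1(0,1)$ be complex valued and let $A(\mu)=(a_{ij}(\mu))$ be a complex $2\times4$ matrix of rank $2$ for every $\mu\in\mathbb C$ (no analyticity or growth condition on the $a_{ij}$ is imposed). Let $y_c(\cdot,\mu)$, $y_s(\cdot,\mu)$ be the solutions of $-y''+qy=\mu^2y$ on $[0,1]$ with $y_c(0)=1$, $y_c'(0)=0$ and $y_s(0)=0$, $y_s'(0)=1$, and let $$B(\mu)=\det\bigl(A(\mu)w_1\,|\,A(\mu)w_2\bigr),\quad w_1=(1,0,y_c(1,\mu),y_c'(1,\mu))^T,\quad w_2=(0,1,y_s(1,\mu),y_s'(1,\mu))^T,$$ be the characteristic function of the eigenvalue problem $-y''+qy=\mu^2y$, $A(\mu)(y(0),y'(0),y(1),y'(1))^T=0$. Let $\theta>0$, let $m\ge2$ be an integer, and put $\sigma=1+m\theta$, $\mu_j=j\pi/\sigma$. Here $\frac{\sin z}{z}$ has the value $1$ at $z=0$. Put $h_{kl}(\mu)=\bigl(\frac{\sin\theta\mu}{\theta\mu}\bigr)^m g_{kl}(\mu)$ with $$g_{11}=y_c(1,\mu)-\cos\mu,\quad g_{12}=y_s(1,\mu)-\tfrac{\sin\mu}{\mu},\quad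 g_{21}=y_c'(1,\mu)+\mu\sin\mu,\quad g_{22}=y_s'(1,\mu)-\cos\mu .$$ For $N\in\mathbb N$ let $h^{[N]}_{kl}(\mu)=\sum_{j=-N}^N h_{kl}(\mu_j)\frac{\sin\sigma(\mu-\mu_j)}{\sigma(\mu-\mu_j)}$, and let $B_N$ be obtained from $B$ by replacing $y_c(1,\mu)$ by $h_{11}^{[N]}(\mu)\bigl(\frac{\sin\theta\mu}{\theta\mu}\bigr)^{-m}+\cos\mu$, and likewise $y_s(1,\mu)$, $y_c'(1,\mu)$, $y_s'(1,\mu)$ by the expressions built from $h_{12}^{[N]}$, $h_{21}^{[N]}$, $h_{22}^{[N]}$. For $\beta>0$ and $|\mu|<N\pi/\sigma$ write $$E_\beta(\mu)=\Bigl|\frac{\sin\theta\mu}{\theta\mu}\Bigr|^{-m}\frac{|\sin\sigma\mu|\,\beta}{\pi(\pi/\sigma)^{m-1}\sqrt{1-4^{-m+1}}},\qquad T_N(\mu)=\frac1{\sqrt{|N\pi/\sigma-\mu|}}+\frac1{\sqrt{|N\pi/\sigma+\mu|}} .$$ Let $S\subset\mathbb C$ be a bounded set on which the $a_{ij}$ are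 bounded and whose closure contains no point $k\pi/\theta$, $k\in\mathbb Z\setminus\{0\}$. Then there is a constant $\beta_4>0$ (independent of $N$, of $\mu\in S$ and of the eigenvalue) such that: (i) $|B(\mu)-B_N(\mu)|\le E_{\beta_4}(\mu)\,T_N(\mu)\,(N+1)^{-(m-1)}$ for all $N$ and all $\mu\in S$ with $|\mu|<N\pi/\sigma$. (ii) For every exact eigenvalue $\overline\mu^2$ of multiplicity $n\ge1$ (that is, $B$ is analytic at $\overline\mu$ and has there a zero of order exactly $n$) there is $r>0$ such that, for every $N$ and every corresponding zero $\mu_N$ of $B_N$ (that is, $\mu_N\in S$, $B_N(\mu_N)=0$ and $|\mu_N-\overline\mu|<r$) with $|\mu_N|<N\pi/\sigma$, if the closed ball $D$ with centre $\mu_N$ and radius $|\mu_N-\overline\mu|$ contains no nonzero multiple of $\pi/\theta$, then $$|\mu_N-\overline\mu|\le\left(\frac{n!}{\inf_{z\in D}|B^{(n)}(z)|}\,E_{\beta_4}(\mu_N)\right)^{1/n}T_N(\mu_N)^{1/n}\,\frac1{(N+1)^{(m-1)/n}} .$$ -/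

import Mathlib

open MeasureTheory Set

namespace RegularizedSampling

noncomputable section

/-- The entire function `sin z / z`, with value `1` at `z = 0`. -/
def csinc (z : ℂ) : ℂ := if z = 0 then 1 else Complex.sin z / z

/-- `y` is the (Carathéodory) solution on `[0,1]` of the initial value problem
`-y'' + q y = μ² y`, `y(0) = a`, `y'(0) = b`, and `dy` is its derivative `y'`.
For integrable `q` the last clause says that `y'` is absolutely continuous on `[0,1]`,
that `y'(0) = b`, and that `y'' = (q - μ²) y` almost everywhere. -/
structure IsIVPSolution (q : ℝ → ℂ) (μ a b : ℂ) (y dy : ℝ → ℂ) : Prop where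
  init : y 0 = a
  hasDeriv : ∀ x ∈ Icc (0 : ℝ) 1, HasDerivWithinAt y (dy x) (Icc 0 1) x
  integral_eq : ∀ x ∈ Icc (0 : ℝ) 1, dy x = b + ∫ t in (0 : ℝ)..x, (q t - μ ^ 2) * y t

/-- The values at `x = 1` of the two base solutions and of their derivatives:
`!![y_c(1,μ), y_s(1,μ); y_c'(1,μ), y_s'(1,μ)]`. -/
def endValues (yc dyc ys dys : ℂ → ℝ → ℂ) (μ : ℂ) : Matrix (Fin 2) (Fin 2) ℂ :=
  !![yc μ 1, ys μ 1; dyc μ 1, dys μ 1]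

/-- The same values for the potential `q = 0`:
`!![cos μ, sin μ / μ; -μ sin μ, cos μ]`. -/
def freeValues (μ : ℂ) : Matrix (Fin 2) (Fin 2) ℂ :=
  !![Complex.cos μ, csinc μ; -(μ * Complex.sin μ), Complex.cos μ]

/-- The determinant of `A (w₁ | w₂)`, where `(w₁ | w₂)` is the `4 × 2` matrix with the
identity above the `2 × 2` matrix `Y` of end values. -/
def boundaryDet (A : Matrix (Fin 2) (Fin 4) ℂ) (Y : Matrix (Fin 2) (Fin 2) ℂ) : ℂ :=
  (A * !![1, 0; 0, 1; Y 0 0, Y 0 1; Y 1 0, Y 1 1]).det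

/-- The characteristic function `B`, from the end values `Y` of the base solutions. -/
def charFun (A : ℂ → Matrix (Fin 2) (Fin 4) ℂ) (Y : ℂ → Matrix (Fin 2) (Fin 2) ℂ)
    (μ : ℂ) : ℂ :=
  boundaryDet (A μ) (Y μ)

/-- The Paley-Wiener type `σ = 1 + m θ` of the regularized functions. -/
def pwType (θ : ℝ) (m : ℕ) : ℝ := 1 + m * θ

/-- The regularized functions `h_{kl}`. -/
def regularized (θ : ℝ) (m : ℕ) (Y : ℂ → Matrix (Fin 2) (Fin 2) ℂ) (k l : Fin 2)
    (μ : ℂ) : ℂ :=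
  csinc (θ * μ) ^ m * (Y μ k l - freeValues μ k l)

/-- The truncated cardinal series of `f` with the nodes `jπ/σ`, `-N ≤ j ≤ N`. -/
def truncCardinal (σ : ℝ) (N : ℕ) (f : ℂ → ℂ) (μ : ℂ) : ℂ :=
  ∑ j ∈ Finset.Icc (-(N : ℤ)) (N : ℤ),
    f ((j * Real.pi / σ : ℝ) : ℂ) * csinc (σ * (μ - ((j * Real.pi / σ : ℝ) : ℂ)))

/-- The approximate end values, recovered from the truncated series of the `h_{kl}`. -/
def approxValues (θ : ℝ) (m N : ℕ) (Y : ℂ → Matrix (Fin 2) (Fin 2) ℂ) (μ : ℂ) :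
    Matrix (Fin 2) (Fin 2) ℂ :=
  Matrix.of fun k l =>
    truncCardinal (pwType θ m) N (regularized θ m Y k l) μ * (csinc (θ * μ) ^ m)⁻¹
      + freeValues μ k l

/-- The approximate characteristic function `B_N`. -/
def approxCharFun (A : ℂ → Matrix (Fin 2) (Fin 4) ℂ) (Y : ℂ → Matrix (Fin 2) (Fin 2) ℂ)
    (θ : ℝ) (m N : ℕ) (μ : ℂ) : ℂ :=
  boundaryDet (A μ) (approxValues θ m N Y μ)

/-- `|sin θμ / (θμ)|^{-m} · |sin σμ| β / (π (π/σ)^{m-1} √(1 - 4^{-m+1}))`. -/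
def errConst (θ : ℝ) (m : ℕ) (β : ℝ) (μ : ℂ) : ℝ :=
  ‖csinc (θ * μ)‖ ^ (-(m : ℤ)) *
    (‖Complex.sin (pwType θ m * μ)‖ * β /
      (Real.pi * (Real.pi / pwType θ m) ^ (m - 1) * √(1 - (4 : ℝ) ^ (-(m : ℤ) + 1))))

/-- `1 / √|Nπ/σ - μ| + 1 / √|Nπ/σ + μ|`. -/
def errBracket (θ : ℝ) (m N : ℕ) (μ : ℂ) : ℝ :=
  1 / √‖((N * Real.pi / pwType θ m : ℝ) : ℂ) - μ‖
    + 1 / √‖((N * Real.pi / pwType θ m : ℝ) : ℂ) + μ‖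

end

end RegularizedSampling

/-! Estimate (i) rests on the decay bought by the factor (sin θμ/θμ)^m. The functions g_kl are
entire (`differentiable_end`, from Wronskian identities) and O(e^{|Im μ|})
(`IsIVPSolution.norm_end_sub_le`, from Duhamel and Grönwall), so each h_kl is entire, O(e^{σ|Im
μ|}), and O(|x|^{-m}) on the real line. Such a function is the sum of its cardinal series: the
difference of the two vanishes at every node, hence by Liouville is a multiple of the sine, and the
smaller growth along the imaginary axis kills that multiple (`hasSum_cardinal`). The tail beyond N
is then estimated term by term (`exists_truncCardinal_error`). The determinant is polynomial in the
end values, hence Lipschitz on bounded sets; the closure of S is compact and avoids the zeros of the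
regularizing factor, so the entry errors pass to B_N with one constant, absorbed into β₄
(`exists_charFun_error`).

For (ii), the equation B_N(μ_N) = 0 turns (i) into a bound for |B(μ_N)|. What remains is |z - a|^n ·
inf_D |B^(n)| ≤ n! |B(z)| for z near a zero a of order n (`exists_radius_pow_le`). The Lagrange form
of Taylor's theorem is not available over ℂ. Instead, write B = (z - a)^n F. If F - F(a) has leading
term c s^k in s = z - a, then B^(n)/n! - F(a) has leading term C(n+k, k) c s^k, with a strictly
larger coefficient. The disc D consists of the points a + us with |u - 1| ≤ 1, and these leave
enough room to make |B^(n)/n!| no larger than |F(z)| somewhere on D (`eventually_exists_norm_le`).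
If F is locally constant, equality holds at z itself. -/

namespace RegularizedSampling

open Filter Topology

/-! ### Absolutely continuous primitives and Grönwall's inequality. -/

section Primitives

theorem absolutelyContinuousOnInterval_of_dist_le {X Y : Type*} [PseudoMetricSpace X]
    [PseudoMetricSpace Y] {f : ℝ → X} {g : ℝ → Y} {a b K : ℝ}
    (hg : AbsolutelyContinuousOnInterval g a b)
    (h : ∀ x ∈ uIcc a b, ∀ y ∈ uIcc a b, dist (f x) (f y) ≤ K * dist (g x) (g y)) :
    AbsolutelyContinuousOnInterval f a b := by
  rw [absolutelyContinuousOnInterval_iff] at hg ⊢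
  intro ε hε
  -- The sign of K is not assumed; |K| + 1 is a positive replacement.
  obtain ⟨δ, hδ, H⟩ := hg (ε / (|K| + 1)) (by positivity)
  refine ⟨δ, hδ, fun E hE hE' ↦ ?_⟩
  have h1 := H E hE hE'
  calc ∑ i ∈ Finset.range E.1, dist (f (E.2 i).1) (f (E.2 i).2)
      ≤ ∑ i ∈ Finset.range E.1, (|K| + 1) * dist (g (E.2 i).1) (g (E.2 i).2) := by
        apply Finset.sum_le_sum
        intro i hi
        have := hE.1 i hi
        refine (h _ this.1 _ this.2).trans ?_
        gcongr
        linarith [le_abs_self K]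
    _ = (|K| + 1) * ∑ i ∈ Finset.range E.1, dist (g (E.2 i).1) (g (E.2 i).2) := by
        rw [Finset.mul_sum]
    _ < (|K| + 1) * (ε / (|K| + 1)) := by gcongr
    _ = ε := by field_simp

/-- Increments of the primitive are dominated by those of the primitive of ‖f‖, which reduces the
vector-valued case to the real one. -/
theorem absolutelyContinuousOnInterval_primitive {E : Type*} [NormedAddCommGroup E]
    [NormedSpace ℝ E] {f : ℝ → E} {a b : ℝ} (hf : IntervalIntegrable f volume a b) :
    AbsolutelyContinuousOnInterval (fun x ↦ ∫ t in a..x, f t) a b := by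
  refine absolutelyContinuousOnInterval_of_dist_le (K := 1)
    (hf.norm.absolutelyContinuousOnInterval_intervalIntegral left_mem_uIcc) ?_
  intro x hx y hy
  have hax : IntervalIntegrable f volume a x := hf.mono_set (uIcc_subset_uIcc_left hx)
  have hay : IntervalIntegrable f volume a y := hf.mono_set (uIcc_subset_uIcc_left hy)
  rw [one_mul, dist_eq_norm, dist_eq_norm, intervalIntegral.integral_interval_sub_left hax hay,
    intervalIntegral.integral_interval_sub_left hax.norm hay.norm]
  exact intervalIntegral.norm_integral_le_abs_integral_norm

variable {𝕜 : Type*} [RCLike 𝕜]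

/-- `F` is a primitive on `[0,1]` of the integrable function `f`. -/
structure IsPrimitive (F f : ℝ → 𝕜) : Prop where
  integrable : IntervalIntegrable f volume 0 1
  eq : ∀ x ∈ Icc (0 : ℝ) 1, F x = F 0 + ∫ t in (0 : ℝ)..x, f t

theorem intervalIntegrable_mono_zero_one {E : Type*} [NormedAddCommGroup E] {f : ℝ → E}
    (hf : IntervalIntegrable f volume 0 1) {x : ℝ} (hx : x ∈ Icc (0 : ℝ) 1) :
    IntervalIntegrable f volume 0 x :=
  hf.mono_set (uIcc_subset_uIcc_left (by rwa [uIcc_of_le zero_le_one]))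

namespace IsPrimitive

variable {F f G g : ℝ → 𝕜}

theorem ac (h : IsPrimitive F f) : AbsolutelyContinuousOnInterval F 0 1 := by
  refine absolutelyContinuousOnInterval_of_dist_le (K := 1)
    (absolutelyContinuousOnInterval_primitive h.integrable) ?_
  intro x hx y hy
  rw [uIcc_of_le zero_le_one] at hx hy
  rw [h.eq x hx, h.eq y hy]
  simp

theorem continuousOn (h : IsPrimitive F f) : ContinuousOn F (Icc 0 1) := by
  simpa using h.ac.continuousOn

theorem ae_hasDerivAt (h : IsPrimitive F f) :
    ∀ᵐ x, x ∈ uIcc (0 : ℝ) 1 → HasDerivAt F (f x) x := by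
  have h0 : ∀ᵐ x : ℝ, x ≠ 0 := by simp [ae_iff, measure_singleton]
  have h1 : ∀ᵐ x : ℝ, x ≠ 1 := by simp [ae_iff, measure_singleton]
  filter_upwards [h.integrable.ae_hasDerivAt_integral, h0, h1] with x hx hx0 hx1 hxI
  have h2 := (hx hxI 0 left_mem_uIcc).const_add (F 0)
  refine h2.congr_of_eventuallyEq ?_
  rw [uIcc_of_le zero_le_one] at hxI
  have : Icc (0 : ℝ) 1 ∈ 𝓝 x :=
    Icc_mem_nhds (lt_of_le_of_ne hxI.1 (Ne.symm hx0)) (lt_of_le_of_ne hxI.2 hx1)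
  filter_upwards [this] with y hy using h.eq y hy

/-- The difference between F and the integral of f is absolutely continuous with derivative zero
almost everywhere, hence constant. -/
theorem of_ac (hF : AbsolutelyContinuousOnInterval F 0 1) (hf : IntervalIntegrable f volume 0 1)
    (hd : ∀ᵐ x, x ∈ uIcc (0 : ℝ) 1 → HasDerivAt F (f x) x) : IsPrimitive F f := by
  refine ⟨hf, fun x hx ↦ ?_⟩
  have hac : AbsolutelyContinuousOnInterval (F - fun x ↦ ∫ t in (0 : ℝ)..x, f t) 0 1 :=
    hF.sub (absolutelyContinuousOnInterval_primitive hf)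
  obtain ⟨C, hC⟩ := hac.const_of_ae_hasDerivAt_zero (by
    filter_upwards [hd, hf.ae_hasDerivAt_integral] with x h1 h2 hx
    simpa using (h1 hx).sub (h2 hx 0 left_mem_uIcc))
  rw [uIcc_of_le zero_le_one] at hC
  have e0 := hC 0 ⟨le_rfl, zero_le_one⟩
  have e1 := hC x hx
  simp only [Pi.sub_apply, intervalIntegral.integral_same, sub_zero] at e0 e1
  rw [e0, ← e1]
  ring

/-- Integration by parts when the derivatives are merely integrable; both the Duhamel formula and
the Wronskian identity come from it. -/
theorem mul (hF : IsPrimitive F f) (hG : IsPrimitive G g) :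
    IsPrimitive (fun x ↦ F x * G x) (fun x ↦ f x * G x + F x * g x) := by
  refine of_ac ?_ ?_ ?_
  · exact hF.ac.smul hG.ac
  · refine (hF.integrable.mul_continuousOn ?_).add (hG.integrable.continuousOn_mul ?_)
    · exact hG.ac.continuousOn
    · exact hF.ac.continuousOn
  · filter_upwards [hF.ae_hasDerivAt, hG.ae_hasDerivAt] with x h1 h2 hx
    exact (h1 hx).mul (h2 hx)

theorem add (hF : IsPrimitive F f) (hG : IsPrimitive G g) :
    IsPrimitive (fun x ↦ F x + G x) (fun x ↦ f x + g x) := by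
  refine ⟨hF.integrable.add hG.integrable, fun x hx ↦ ?_⟩
  rw [intervalIntegral.integral_add (intervalIntegrable_mono_zero_one hF.integrable hx)
    (intervalIntegrable_mono_zero_one hG.integrable hx), hF.eq x hx, hG.eq x hx]
  ring

theorem sub (hF : IsPrimitive F f) (hG : IsPrimitive G g) :
    IsPrimitive (fun x ↦ F x - G x) (fun x ↦ f x - g x) := by
  refine ⟨hF.integrable.sub hG.integrable, fun x hx ↦ ?_⟩
  rw [intervalIntegral.integral_sub (intervalIntegrable_mono_zero_one hF.integrable hx)
    (intervalIntegrable_mono_zero_one hG.integrable hx), hF.eq x hx, hG.eq x hx]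
  ring

theorem congr (hF : IsPrimitive F f) (h : ∀ x ∈ Icc (0 : ℝ) 1, f x = g x) :
    IsPrimitive F g := by
  have h' : EqOn f g (uIoc 0 1) := fun x hx ↦ h x (by
    rw [uIoc_of_le zero_le_one] at hx; exact Ioc_subset_Icc_self hx)
  refine ⟨hF.integrable.congr h', fun x hx ↦ ?_⟩
  rw [hF.eq x hx, intervalIntegral.integral_congr]
  intro t ht
  rw [uIcc_of_le hx.1] at ht
  exact h t ⟨ht.1, ht.2.trans hx.2⟩

theorem of_hasDerivWithinAt (h : ∀ x ∈ Icc (0 : ℝ) 1, HasDerivWithinAt F (f x) (Icc 0 1) x)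
    (hf : ContinuousOn f (Icc 0 1)) : IsPrimitive F f := by
  have hfi : IntervalIntegrable f volume 0 1 := by
    apply ContinuousOn.intervalIntegrable
    rwa [uIcc_of_le zero_le_one]
  refine ⟨hfi, fun x hx ↦ ?_⟩
  have := intervalIntegral.integral_eq_sub_of_hasDerivAt_of_le hx.1
    (f := F) (f' := f) (fun t ht ↦ ?_) (fun t ht ↦ ?_) (intervalIntegrable_mono_zero_one hfi hx)
  · rw [this]; ring
  · exact ((h t ⟨ht.1, ht.2.trans hx.2⟩).continuousWithinAt).mono (Icc_subset_Icc le_rfl hx.2)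
  · exact (h t ⟨ht.1.le, ht.2.le.trans hx.2⟩).hasDerivAt
      (Icc_mem_nhds ht.1 (ht.2.trans_le hx.2))

end IsPrimitive

/-- Grönwall's inequality with an integrable coefficient. -/
theorem le_mul_exp_of_le_add_integral {u k : ℝ → ℝ} {a : ℝ}
    (hu : ContinuousOn u (Icc 0 1)) (hk : IntervalIntegrable k volume 0 1) (hk0 : ∀ x, 0 ≤ k x)
    (h : ∀ x ∈ Icc (0 : ℝ) 1, u x ≤ a + ∫ t in (0 : ℝ)..x, k t * u t) :
    ∀ x ∈ Icc (0 : ℝ) 1, u x ≤ a * Real.exp (∫ t in (0 : ℝ)..x, k t) := by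
  set Q : ℝ → ℝ := fun x ↦ ∫ t in (0 : ℝ)..x, k t with hQ
  have hQp : IsPrimitive Q k := ⟨hk, fun x _ ↦ by simp [hQ]⟩
  have hku : IntervalIntegrable (fun t ↦ k t * u t) volume 0 1 :=
    hk.mul_continuousOn (by rwa [uIcc_of_le zero_le_one])
  set W : ℝ → ℝ := fun x ↦ a + ∫ t in (0 : ℝ)..x, k t * u t with hW
  have hWp : IsPrimitive W (fun t ↦ k t * u t) := ⟨hku, fun x _ ↦ by simp [hW]⟩
  have hQ0 : ∀ x ∈ Icc (0 : ℝ) 1, 0 ≤ Q x := fun x hx ↦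
    intervalIntegral.integral_nonneg hx.1 (fun t _ ↦ hk0 t)
  set E : ℝ → ℝ := fun x ↦ Real.exp (-Q x) with hE
  have hEc : ContinuousOn E (uIcc 0 1) :=
    Real.continuous_exp.comp_continuousOn hQp.ac.continuousOn.neg
  have hEp : IsPrimitive E (fun t ↦ k t * (-E t)) := by
    refine IsPrimitive.of_ac ?_ (hk.mul_continuousOn hEc.neg) ?_
    -- On [0, ∞), where Q takes its values, s ↦ e^{-s} is 1-Lipschitz, so E inherits absolute
    -- continuity from Q.
    · refine absolutelyContinuousOnInterval_of_dist_le (K := 1) hQp.ac ?_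
      intro x hx y hy
      rw [uIcc_of_le zero_le_one] at hx hy
      have key := Convex.norm_image_sub_le_of_norm_hasDerivWithin_le (𝕜 := ℝ) (C := 1)
        (f := fun s ↦ Real.exp (-s)) (f' := fun s ↦ Real.exp (-s) * (-1)) (s := Ici 0)
        (x := Q y) (y := Q x)
        (fun s _ ↦ ((Real.hasDerivAt_exp (-s)).comp s (hasDerivAt_neg s)).hasDerivWithinAt)
        (fun s hs ↦ by
          have : (0 : ℝ) ≤ s := hs
          simpa using this) (convex_Ici 0) (hQ0 y hy) (hQ0 x hx)
      simpa [dist_eq_norm] using key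
    · filter_upwards [hQp.ae_hasDerivAt] with x h1 hx
      have h3 : k x * -E x = Real.exp (-Q x) * -k x := by simp only [hE]; ring
      rw [h3]
      exact (Real.hasDerivAt_exp (-Q x)).comp x (h1 hx).neg
  intro x hx
  have hWE := (hWp.mul hEp).eq x hx
  -- The derivative of W e^{-Q} is -k e^{-Q} (W - u), which is nonpositive by the hypothesis u ≤ W.
  have hle : ∫ t in (0 : ℝ)..x, (k t * u t * E t + W t * (k t * -E t)) ≤ 0 := by
    rw [← neg_nonneg, ← intervalIntegral.integral_neg]
    refine intervalIntegral.integral_nonneg hx.1 ?_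
    intro t ht
    have h1 := h t ⟨ht.1, ht.2.trans hx.2⟩
    have h2 : 0 < E t := Real.exp_pos _
    have h3 : k t * u t * E t + W t * (k t * -E t) = -(k t * E t * (W t - u t)) := by ring
    rw [h3]
    have : 0 ≤ W t - u t := sub_nonneg.2 h1
    have := mul_nonneg (mul_nonneg (hk0 t) h2.le) this
    linarith
  have h0 : W 0 * E 0 = a := by simp [hW, hE, hQ]
  have h4 : W x * E x ≤ a := by linarith
  have h5 : W x = W x * E x * Real.exp (Q x) := by
    rw [mul_assoc, hE, ← Real.exp_add]; simp
  calc u x ≤ W x := h x hx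
    _ = W x * E x * Real.exp (Q x) := h5
    _ ≤ a * Real.exp (Q x) := by gcongr

end Primitives

/-! ### Growth of the trigonometric functions in the complex plane. -/

section Trigonometric

theorem norm_exp_le (z : ℂ) : ‖Complex.exp (z * Complex.I)‖ ≤ Real.exp |z.im| := by
  rw [Complex.norm_exp]
  apply Real.exp_le_exp.2
  simp [neg_le_abs]

theorem norm_cos_le (z : ℂ) : ‖Complex.cos z‖ ≤ Real.exp |z.im| := by
  rw [Complex.cos]
  have h1 := norm_exp_le z
  have h2 := norm_exp_le (-z)
  simp only [Complex.neg_im, abs_neg] at h2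
  rw [norm_div, Complex.norm_ofNat, div_le_iff₀ two_pos]
  linarith [norm_add_le (Complex.exp (z * Complex.I)) (Complex.exp (-z * Complex.I))]

theorem norm_sin_le (z : ℂ) : ‖Complex.sin z‖ ≤ Real.exp |z.im| := by
  rw [Complex.sin]
  have h1 := norm_exp_le z
  have h2 := norm_exp_le (-z)
  simp only [Complex.neg_im, abs_neg] at h2
  rw [norm_div, Complex.norm_ofNat, div_le_iff₀ two_pos, norm_mul, Complex.norm_I, mul_one]
  linarith [norm_sub_le (Complex.exp (-z * Complex.I)) (Complex.exp (z * Complex.I))]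

/-- Mean value inequality for the sine between 0 and z, inside the convex strip |Im w| ≤ |Im z|
where the cosine is at most e^{|Im z|}. -/
theorem norm_csinc_le (z : ℂ) : ‖csinc z‖ ≤ Real.exp |z.im| := by
  rw [csinc]
  split_ifs with h
  · simp [h]
  · have hconv : Convex ℝ {w : ℂ | |w.im| ≤ |z.im|} := by
      have : {w : ℂ | |w.im| ≤ |z.im|} = Complex.imLm ⁻¹' Icc (-|z.im|) |z.im| := by
        ext w; simp [abs_le]
      rw [this]
      exact (convex_Icc _ _).linear_preimage _
    have key := hconv.norm_image_sub_le_of_norm_hasDerivWithin_le (𝕜 := ℂ)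
      (f := Complex.sin) (f' := Complex.cos) (C := Real.exp |z.im|) (x := 0) (y := z)
      (fun w _ ↦ (Complex.hasDerivAt_sin w).hasDerivWithinAt)
      (fun w hw ↦ (norm_cos_le w).trans (Real.exp_le_exp.2 hw)) (show |(0 : ℂ).im| ≤ |z.im| by simp) (show |z.im| ≤ |z.im| from le_rfl)
    simp only [Complex.sin_zero, sub_zero] at key
    rw [norm_div, div_le_iff₀ (norm_pos_iff.2 h)]
    exact key

theorem mul_csinc (z : ℂ) : z * csinc z = Complex.sin z := by
  rw [csinc]
  split_ifs with h
  · simp [h]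
  · field_simp

theorem csinc_eq_dslope : csinc = dslope Complex.sin 0 := by
  ext z
  rw [csinc]
  split_ifs with h
  · simp [h]
  · rw [dslope_of_ne _ h, slope_def_field]; simp

theorem differentiable_csinc : Differentiable ℂ csinc := by
  rw [csinc_eq_dslope]
  intro z
  have := (Complex.differentiableOn_dslope (f := Complex.sin) (s := univ) (c := 0)
    Filter.univ_mem).2 Complex.differentiable_sin.differentiableOn
  exact (this z (mem_univ z)).differentiableAt Filter.univ_mem

end Trigonometric

/-! ### Variation of constants. -/

section Duhamel

variable {y dy f : ℝ → ℂ} {μ b : ℂ}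

theorem hasDerivAt_cos_sub (μ : ℂ) (x t : ℝ) :
    HasDerivAt (fun t : ℝ ↦ Complex.cos (μ * (x - t))) (μ * Complex.sin (μ * (x - t))) t := by
  have h1 : HasDerivAt (fun t : ℝ ↦ μ * ((x : ℂ) - (t : ℂ))) (μ * (-1)) t :=
    ((Complex.ofRealCLM.hasDerivAt (x := t)).const_sub (x : ℂ)).const_mul μ
  convert! (Complex.hasDerivAt_cos _).comp t h1 using 1
  ring

theorem hasDerivAt_mul_sin_sub (μ : ℂ) (x t : ℝ) :
    HasDerivAt (fun t : ℝ ↦ μ * Complex.sin (μ * (x - t)))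
      (-(μ ^ 2 * Complex.cos (μ * (x - t)))) t := by
  have h1 : HasDerivAt (fun t : ℝ ↦ μ * ((x : ℂ) - (t : ℂ))) (μ * (-1)) t :=
    ((Complex.ofRealCLM.hasDerivAt (x := t)).const_sub (x : ℂ)).const_mul μ
  convert! ((Complex.hasDerivAt_sin _).comp t h1).const_mul μ using 1
  ring

/-- Writing sin(μ(x - t))/μ as (x - t) times a sinc keeps the kernel meaningful at μ = 0. -/
theorem hasDerivAt_mul_csinc_sub (μ : ℂ) (x t : ℝ) :
    HasDerivAt (fun t : ℝ ↦ ((x : ℂ) - t) * csinc (μ * (x - t)))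
      (-Complex.cos (μ * (x - t))) t := by
  have h0 : HasDerivAt (fun t : ℝ ↦ ((x : ℂ) - (t : ℂ))) (-1) t :=
    ((Complex.ofRealCLM.hasDerivAt (x := t)).const_sub (x : ℂ))
  by_cases hμ : μ = 0
  · subst hμ
    simpa [csinc] using h0
  · have h1 : HasDerivAt (fun t : ℝ ↦ μ * ((x : ℂ) - (t : ℂ))) (μ * (-1)) t := h0.const_mul μ
    have h2 := (((Complex.hasDerivAt_sin _).comp t h1).const_mul μ⁻¹)
    have e : (fun t : ℝ ↦ ((x : ℂ) - t) * csinc (μ * (x - t)))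
        = fun t : ℝ ↦ μ⁻¹ * (Complex.sin ∘ fun t : ℝ ↦ μ * ((x : ℂ) - (t : ℂ))) t := by
      ext t
      rw [Function.comp_apply, ← mul_csinc]
      field_simp
    rw [e]
    convert! h2 using 1
    field_simp

theorem isPrimitive_of_hasDerivAt {F f : ℝ → ℂ} (h : ∀ t, HasDerivAt F (f t) t)
    (hf : Continuous f) : IsPrimitive F f :=
  .of_hasDerivWithinAt (fun x _ ↦ (h x).hasDerivWithinAt) hf.continuousOn

/-- With c(t) = cos μ(x - t) and s(t) = (x - t) sinc μ(x - t), the function y c + y' s has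
derivative s f: the terms in y and y' cancel. Likewise y' c - y c' has derivative c f. Integrating
from 0 to x gives both formulas. -/
theorem duhamel (hy : ∀ x ∈ Icc (0 : ℝ) 1, HasDerivWithinAt y (dy x) (Icc 0 1) x)
    (hf : IntervalIntegrable f volume 0 1)
    (hdy : ∀ x ∈ Icc (0 : ℝ) 1, dy x = b + ∫ t in (0 : ℝ)..x, (f t - μ ^ 2 * y t))
    {x : ℝ} (hx : x ∈ Icc (0 : ℝ) 1) :
    y x = y 0 * Complex.cos (μ * x) + b * (x * csinc (μ * x))
        + ∫ t in (0 : ℝ)..x, (x - t) * csinc (μ * (x - t)) * f t ∧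
    dy x = -(y 0 * (μ * Complex.sin (μ * x))) + b * Complex.cos (μ * x)
        + ∫ t in (0 : ℝ)..x, Complex.cos (μ * (x - t)) * f t := by
  have hyc : ContinuousOn y (Icc 0 1) := fun x hx ↦ (hy x hx).continuousWithinAt
  have hyi : IntervalIntegrable y volume 0 1 := by
    apply ContinuousOn.intervalIntegrable; rwa [uIcc_of_le zero_le_one]
  have hdy0 : dy 0 = b := by simpa using hdy 0 ⟨le_rfl, zero_le_one⟩
  have hdp : IsPrimitive dy (fun t ↦ f t - μ ^ 2 * y t) :=
    ⟨hf.sub (hyi.const_mul _), fun x hx ↦ by rw [hdy x hx, hdy0]⟩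
  have hyp : IsPrimitive y dy := .of_hasDerivWithinAt hy hdp.continuousOn
  have hcos : Continuous fun t : ℝ ↦ Complex.cos (μ * (x - t)) := by fun_prop
  have hsin : Continuous fun t : ℝ ↦ μ * Complex.sin (μ * (x - t)) := by fun_prop
  have c1 := isPrimitive_of_hasDerivAt (hasDerivAt_cos_sub μ x) hsin
  have c2 := isPrimitive_of_hasDerivAt (hasDerivAt_mul_sin_sub μ x) (by fun_prop)
  have c3 := isPrimitive_of_hasDerivAt (hasDerivAt_mul_csinc_sub μ x) (by fun_prop)
  constructor
  · have h := ((hyp.mul c1).add (hdp.mul c3)).congr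
      (g := fun t ↦ (x - t) * csinc (μ * (x - t)) * f t) (fun t _ ↦ by
        rw [← mul_csinc (μ * (x - t))]; ring)
    have := h.eq x hx
    simp only [sub_self, mul_zero, Complex.cos_zero, mul_one, zero_mul, add_zero,
      Complex.ofReal_zero, sub_zero, hdy0] at this
    rw [this]
  · have h := ((hdp.mul c1).sub (hyp.mul c2)).congr
      (g := fun t ↦ Complex.cos (μ * (x - t)) * f t) (fun t _ ↦ by ring)
    have := h.eq x hx
    simp only [sub_self, mul_zero, Complex.cos_zero, mul_one, Complex.sin_zero, sub_zero,
      Complex.ofReal_zero, hdy0] at this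
    rw [this]
    ring

end Duhamel

section Volterra

theorem norm_mul_csinc_le (μ : ℂ) {x t : ℝ} (hx : x ∈ Icc (0 : ℝ) 1) (ht : t ∈ Icc 0 x) :
    ‖((x : ℂ) - t) * csinc (μ * (x - t))‖ ≤ Real.exp (|μ.im| * (x - t)) := by
  have h0 : 0 ≤ x - t := sub_nonneg.2 ht.2
  have h1 : x - t ≤ 1 := by linarith [hx.2, ht.1]
  have h2 := norm_csinc_le (μ * (x - t))
  have h3 : (μ * ((x : ℂ) - t)).im = μ.im * (x - t) := by
    rw [← Complex.ofReal_sub, Complex.im_mul_ofReal]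
  rw [h3, abs_mul, abs_of_nonneg h0] at h2
  rw [norm_mul, ← Complex.ofReal_sub, Complex.norm_real, Real.norm_of_nonneg h0,
    Complex.ofReal_sub]
  calc (x - t) * ‖csinc (μ * (x - t))‖ ≤ 1 * Real.exp (|μ.im| * (x - t)) := by gcongr
    _ = _ := one_mul _

theorem norm_cos_mul_sub_le (μ : ℂ) {x t : ℝ} (ht : t ∈ Icc 0 x) :
    ‖Complex.cos (μ * (x - t))‖ ≤ Real.exp (|μ.im| * (x - t)) := by
  have h0 : 0 ≤ x - t := sub_nonneg.2 ht.2
  have h2 := norm_cos_le (μ * (x - t))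
  have h3 : (μ * ((x : ℂ) - t)).im = μ.im * (x - t) := by
    rw [← Complex.ofReal_sub, Complex.im_mul_ofReal]
  rwa [h3, abs_mul, abs_of_nonneg h0] at h2

theorem norm_integral_kernel_mul_le {k f : ℝ → ℂ} {x τ : ℝ} (hx : x ∈ Icc (0 : ℝ) 1)
    (hf : IntervalIntegrable f volume 0 1)
    (hk : ∀ t ∈ Icc 0 x, ‖k t‖ ≤ Real.exp (τ * (x - t))) :
    ‖∫ t in (0 : ℝ)..x, k t * f t‖ ≤ ∫ t in (0 : ℝ)..x, Real.exp (τ * (x - t)) * ‖f t‖ := by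
  apply intervalIntegral.norm_integral_le_of_norm_le hx.1
  · refine Eventually.of_forall fun t ht ↦ ?_
    rw [norm_mul]
    gcongr
    exact hk t (Ioc_subset_Icc_self ht)
  · exact (intervalIntegrable_mono_zero_one hf hx).norm.continuousOn_mul
      (Continuous.continuousOn (by fun_prop))

end Volterra

/-! ### Growth, Wronskian and parameter dependence of solutions. -/

namespace IsIVPSolution

variable {q : ℝ → ℂ} {μ a b : ℂ} {y dy : ℝ → ℂ}

theorem continuousOn (h : IsIVPSolution q μ a b y dy) : ContinuousOn y (Icc 0 1) :=
  fun x hx ↦ (h.hasDeriv x hx).continuousWithinAt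

theorem continuousOn_uIcc (h : IsIVPSolution q μ a b y dy) : ContinuousOn y (uIcc 0 1) := by
  rw [uIcc_of_le zero_le_one]; exact h.continuousOn

theorem intervalIntegrable_mul (hq : IntervalIntegrable q volume 0 1)
    (h : IsIVPSolution q μ a b y dy) : IntervalIntegrable (fun t ↦ q t * y t) volume 0 1 :=
  hq.mul_continuousOn h.continuousOn_uIcc

theorem dy_zero (h : IsIVPSolution q μ a b y dy) : dy 0 = b := by
  simpa using h.integral_eq 0 ⟨le_rfl, zero_le_one⟩

theorem isPrimitive_dy (hq : IntervalIntegrable q volume 0 1) (h : IsIVPSolution q μ a b y dy) :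
    IsPrimitive dy (fun t ↦ (q t - μ ^ 2) * y t) := by
  refine ⟨?_, fun x hx ↦ by rw [h.integral_eq x hx, h.dy_zero]⟩
  exact (hq.sub intervalIntegrable_const).mul_continuousOn h.continuousOn_uIcc

theorem isPrimitive (hq : IntervalIntegrable q volume 0 1) (h : IsIVPSolution q μ a b y dy) :
    IsPrimitive y dy :=
  .of_hasDerivWithinAt h.hasDeriv (h.isPrimitive_dy hq).continuousOn

theorem eq_duhamel (hq : IntervalIntegrable q volume 0 1) (h : IsIVPSolution q μ a b y dy)
    {x : ℝ} (hx : x ∈ Icc (0 : ℝ) 1) :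
    y x = a * Complex.cos (μ * x) + b * (x * csinc (μ * x))
        + ∫ t in (0 : ℝ)..x, (x - t) * csinc (μ * (x - t)) * (q t * y t) ∧
    dy x = -(a * (μ * Complex.sin (μ * x))) + b * Complex.cos (μ * x)
        + ∫ t in (0 : ℝ)..x, Complex.cos (μ * (x - t)) * (q t * y t) := by
  have := duhamel (μ := μ) (b := b) h.hasDeriv (h.intervalIntegrable_mul hq) (fun x hx ↦ by
    rw [h.integral_eq x hx]; simp only [sub_mul]) hx
  rwa [h.init] at this

/-- Grönwall applied to e^{-|Im μ| x} ‖y x‖; this weight exactly absorbs the growth of the Duhamel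
kernel. -/
theorem norm_le (hq : IntervalIntegrable q volume 0 1) (h : IsIVPSolution q μ a b y dy)
    {x : ℝ} (hx : x ∈ Icc (0 : ℝ) 1) :
    ‖y x‖ ≤ (‖a‖ + ‖b‖) * Real.exp (∫ t in (0 : ℝ)..1, ‖q t‖) * Real.exp (|μ.im| * x) := by
  set τ := |μ.im|
  have key := le_mul_exp_of_le_add_integral (u := fun x ↦ Real.exp (-(τ * x)) * ‖y x‖)
    (k := fun t ↦ ‖q t‖) (a := ‖a‖ + ‖b‖)
    ((Continuous.continuousOn (by fun_prop)).mul h.continuousOn.norm) hq.norm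
    (fun _ ↦ norm_nonneg _) (fun x hx ↦ ?_) x hx
  · have h1 : ‖y x‖ = Real.exp (τ * x) * (Real.exp (-(τ * x)) * ‖y x‖) := by
      rw [← mul_assoc, ← Real.exp_add]; simp
    have h2 : ∫ t in (0 : ℝ)..x, ‖q t‖ ≤ ∫ t in (0 : ℝ)..1, ‖q t‖ :=
      intervalIntegral.integral_mono_interval le_rfl hx.1 hx.2
        (Eventually.of_forall fun _ ↦ norm_nonneg _) hq.norm
    rw [h1, mul_comm]
    refine mul_le_mul_of_nonneg_right (key.trans ?_) (Real.exp_pos _).le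
    gcongr
  · have hc := norm_cos_mul_sub_le μ (x := x) (t := 0) ⟨le_rfl, hx.1⟩
    have hs := norm_mul_csinc_le μ hx (t := 0) ⟨le_rfl, hx.1⟩
    simp only [Complex.ofReal_zero, sub_zero] at hc hs
    have hi := norm_integral_kernel_mul_le hx (h.intervalIntegrable_mul hq)
      (fun t ht ↦ norm_mul_csinc_le μ hx ht)
    have e : ∫ t in (0 : ℝ)..x, Real.exp (τ * (x - t)) * ‖q t * y t‖
        = Real.exp (τ * x) * ∫ t in (0 : ℝ)..x, ‖q t‖ * (Real.exp (-(τ * t)) * ‖y t‖) := by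
      rw [← intervalIntegral.integral_const_mul]
      congr 1
      ext t
      rw [norm_mul, mul_sub, sub_eq_add_neg, Real.exp_add]
      ring
    have hy : ‖y x‖ ≤ ‖a‖ * Real.exp (τ * x) + ‖b‖ * Real.exp (τ * x)
        + Real.exp (τ * x) * ∫ t in (0 : ℝ)..x, ‖q t‖ * (Real.exp (-(τ * t)) * ‖y t‖) := by
      rw [(h.eq_duhamel hq hx).1, ← e]
      refine (norm_add₃_le).trans ?_
      rw [norm_mul, norm_mul]
      gcongr
    calc Real.exp (-(τ * x)) * ‖y x‖
        ≤ Real.exp (-(τ * x)) * (‖a‖ * Real.exp (τ * x) + ‖b‖ * Real.exp (τ * x)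
          + Real.exp (τ * x) * ∫ t in (0 : ℝ)..x, ‖q t‖ * (Real.exp (-(τ * t)) * ‖y t‖)) := by
          gcongr
      _ = (Real.exp (-(τ * x)) * Real.exp (τ * x)) * (‖a‖ + ‖b‖
        + ∫ t in (0 : ℝ)..x, ‖q t‖ * (Real.exp (-(τ * t)) * ‖y t‖)) := by ring
      _ = _ := by rw [← Real.exp_add]; simp

theorem integral_exp_mul_le (hq : IntervalIntegrable q volume 0 1)
    (h : IsIVPSolution q μ a b y dy) :
    ∫ t in (0 : ℝ)..1, Real.exp (|μ.im| * (1 - t)) * ‖q t * y t‖ ≤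
      (‖a‖ + ‖b‖) * Real.exp (∫ t in (0 : ℝ)..1, ‖q t‖) * (∫ t in (0 : ℝ)..1, ‖q t‖)
        * Real.exp |μ.im| := by
  set K := (‖a‖ + ‖b‖) * Real.exp (∫ t in (0 : ℝ)..1, ‖q t‖) with hK
  have e : K * (∫ t in (0 : ℝ)..1, ‖q t‖) * Real.exp |μ.im|
      = ∫ t in (0 : ℝ)..1, (K * Real.exp |μ.im|) * ‖q t‖ := by
    rw [intervalIntegral.integral_const_mul]; ring
  rw [e]
  apply intervalIntegral.integral_mono_on zero_le_one
  · exact (h.intervalIntegrable_mul hq).norm.continuousOn_mul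
      (Continuous.continuousOn (by fun_prop))
  · exact hq.norm.const_mul _
  · intro t ht
    have h1 := h.norm_le hq ht
    rw [← hK] at h1
    calc Real.exp (|μ.im| * (1 - t)) * ‖q t * y t‖
        ≤ Real.exp (|μ.im| * (1 - t)) * (‖q t‖ * (K * Real.exp (|μ.im| * t))) := by
          rw [norm_mul]; gcongr
      _ = K * (Real.exp (|μ.im| * (1 - t)) * Real.exp (|μ.im| * t)) * ‖q t‖ := by ring
      _ = K * Real.exp |μ.im| * ‖q t‖ := by
          rw [← Real.exp_add]; ring_nf

/-- The end values of a solution differ from those of the free equation by `O(e^{|Im μ|})`. -/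
theorem norm_end_sub_le (hq : IntervalIntegrable q volume 0 1)
    (h : IsIVPSolution q μ a b y dy) :
    ‖y 1 - (a * Complex.cos μ + b * csinc μ)‖ ≤
      (‖a‖ + ‖b‖) * Real.exp (∫ t in (0 : ℝ)..1, ‖q t‖) * (∫ t in (0 : ℝ)..1, ‖q t‖)
        * Real.exp |μ.im| ∧
    ‖dy 1 - (-(a * (μ * Complex.sin μ)) + b * Complex.cos μ)‖ ≤
      (‖a‖ + ‖b‖) * Real.exp (∫ t in (0 : ℝ)..1, ‖q t‖) * (∫ t in (0 : ℝ)..1, ‖q t‖)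
        * Real.exp |μ.im| := by
  have h1 : (1 : ℝ) ∈ Icc (0 : ℝ) 1 := ⟨zero_le_one, le_rfl⟩
  obtain ⟨e1, e2⟩ := h.eq_duhamel hq h1
  constructor
  · refine le_trans ?_ (h.integral_exp_mul_le hq)
    refine le_trans (le_of_eq ?_) (norm_integral_kernel_mul_le h1 (h.intervalIntegrable_mul hq)
      (fun t ht ↦ norm_mul_csinc_le μ h1 ht))
    rw [e1]
    simp
  · refine le_trans ?_ (h.integral_exp_mul_le hq)
    refine le_trans (le_of_eq ?_) (norm_integral_kernel_mul_le h1 (h.intervalIntegrable_mul hq)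
      (fun t ht ↦ norm_cos_mul_sub_le μ ht))
    rw [e2]
    simp

/-- The Wronskian identity for two solutions with different spectral parameters. -/
theorem wronskian {l c d : ℂ} {u du : ℝ → ℂ} (hq : IntervalIntegrable q volume 0 1)
    (h : IsIVPSolution q l a b y dy) (h' : IsIVPSolution q μ c d u du) :
    y 1 * du 1 - dy 1 * u 1 = a * d - b * c + (l ^ 2 - μ ^ 2) * ∫ t in (0 : ℝ)..1, y t * u t := by
  have hp := (((h.isPrimitive hq).mul (h'.isPrimitive_dy hq)).sub
    ((h.isPrimitive_dy hq).mul (h'.isPrimitive hq))).congr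
      (g := fun t ↦ (l ^ 2 - μ ^ 2) * (y t * u t)) (fun t _ ↦ by ring)
  have := hp.eq 1 ⟨zero_le_one, le_rfl⟩
  rw [intervalIntegral.integral_const_mul] at this
  simpa [h.init, h'.init, h.dy_zero, h'.dy_zero] using this

/-- Solutions depend continuously on the spectral parameter. -/
theorem exists_norm_sub_le (hq : IntervalIntegrable q volume 0 1)
    (h : IsIVPSolution q μ a b y dy) :
    ∃ K : ℝ, ∀ (l : ℂ) (z dz : ℝ → ℂ), IsIVPSolution q l a b z dz → ‖l - μ‖ ≤ 1 →
      ∀ x ∈ Icc (0 : ℝ) 1, ‖z x - y x‖ ≤ K * ‖l ^ 2 - μ ^ 2‖ := by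
  set τ := |μ.im| with hτ
  set C := (‖a‖ + ‖b‖) * Real.exp (∫ t in (0 : ℝ)..1, ‖q t‖) with hC
  have hC0 : 0 ≤ C := by positivity
  set Q := ∫ t in (0 : ℝ)..1, Real.exp τ * ‖q t‖ with hQ
  refine ⟨Real.exp τ * (C * Real.exp (τ + 1)) * Real.exp Q, fun l z dz hz hl x hx ↦ ?_⟩
  set D := ‖l ^ 2 - μ ^ 2‖ with hD
  have hzb : ∀ x ∈ Icc (0 : ℝ) 1, ‖z x‖ ≤ C * Real.exp (τ + 1) := by
    intro x hx
    refine (hz.norm_le hq hx).trans ?_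
    rw [← hC]
    gcongr
    have h1 : |l.im| ≤ τ + 1 := by
      have h2 := (Complex.abs_im_le_norm (l - μ)).trans hl
      rw [Complex.sub_im] at h2
      linarith [abs_sub_abs_le_abs_sub l.im μ.im]
    calc |l.im| * x ≤ |l.im| * 1 := by gcongr; exact hx.2
      _ ≤ τ + 1 := by linarith
  have hwc : ContinuousOn (fun t ↦ z t - y t) (Icc 0 1) := hz.continuousOn.sub h.continuousOn
  have hzi : IntervalIntegrable z volume 0 1 := hz.continuousOn_uIcc.intervalIntegrable
  have hfi : IntervalIntegrable (fun t ↦ q t * (z t - y t) - (l ^ 2 - μ ^ 2) * z t)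
      volume 0 1 := by
    refine (hq.mul_continuousOn ?_).sub (hzi.const_mul _)
    rwa [uIcc_of_le zero_le_one]
  have hdw := (hz.isPrimitive_dy hq).sub (h.isPrimitive_dy hq)
  -- The difference solves the free equation at the fixed parameter μ with forcing q(z - y) - (l² -
  -- μ²) z and zero initial data; the last term, bounded by `hzb`, is the source of the factor ‖l² -
  -- μ²‖.
  have hd : ∀ x ∈ Icc (0 : ℝ) 1, z x - y x = ∫ t in (0 : ℝ)..x,
      (x - t) * csinc (μ * (x - t)) * (q t * (z t - y t) - (l ^ 2 - μ ^ 2) * z t) := by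
    intro x hx
    have := (duhamel (y := fun t ↦ z t - y t) (dy := fun t ↦ dz t - dy t) (μ := μ) (b := 0)
      (fun x hx ↦ (hz.hasDeriv x hx).sub (h.hasDeriv x hx)) hfi (fun x hx ↦ by
        have := hdw.eq x hx
        rw [this]
        simp only [hz.dy_zero, h.dy_zero, sub_self, zero_add]
        congr 1
        ext t
        ring) hx).1
    simpa [hz.init, h.init] using this
  have key := le_mul_exp_of_le_add_integral (u := fun x ↦ ‖z x - y x‖)
    (k := fun t ↦ Real.exp τ * ‖q t‖) (a := Real.exp τ * (C * Real.exp (τ + 1)) * D)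
    hwc.norm (hq.norm.const_mul _) (fun _ ↦ by positivity) (fun x hx ↦ ?_) x hx
  · refine key.trans ?_
    have h2 : ∫ t in (0 : ℝ)..x, Real.exp τ * ‖q t‖ ≤ Q :=
      intervalIntegral.integral_mono_interval le_rfl hx.1 hx.2
        (Eventually.of_forall fun t ↦ by positivity) (hq.norm.const_mul _)
    calc _ ≤ Real.exp τ * (C * Real.exp (τ + 1)) * D * Real.exp Q := by gcongr
      _ = _ := by ring
  · have hi := norm_integral_kernel_mul_le hx hfi (fun t ht ↦ norm_mul_csinc_le μ hx ht)
    rw [← hd x hx] at hi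
    refine hi.trans ?_
    have hki : IntervalIntegrable (fun t ↦ Real.exp τ * ‖q t‖ * ‖z t - y t‖) volume 0 x :=
      intervalIntegrable_mono_zero_one ((hq.norm.const_mul _).mul_continuousOn (by
        rw [uIcc_of_le zero_le_one]; exact hwc.norm)) hx
    have hmono : ∫ t in (0 : ℝ)..x, Real.exp (τ * (x - t)) *
          ‖q t * (z t - y t) - (l ^ 2 - μ ^ 2) * z t‖
        ≤ ∫ t in (0 : ℝ)..x, (Real.exp τ * (C * Real.exp (τ + 1)) * D
            + Real.exp τ * ‖q t‖ * ‖z t - y t‖) := by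
      apply intervalIntegral.integral_mono_on hx.1
      · exact intervalIntegrable_mono_zero_one (hfi.norm.continuousOn_mul
          (Continuous.continuousOn (by fun_prop))) hx
      · exact intervalIntegrable_const.add hki
      · intro t ht
        have ht1 : t ∈ Icc (0 : ℝ) 1 := ⟨ht.1, ht.2.trans hx.2⟩
        have h3 : τ * (x - t) ≤ τ := by
          have : x - t ≤ 1 := by linarith [hx.2, ht.1]
          calc τ * (x - t) ≤ τ * 1 := by gcongr
            _ = τ := mul_one _
        calc _ ≤ Real.exp τ * (‖q t‖ * ‖z t - y t‖ + D * (C * Real.exp (τ + 1))) := by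
              gcongr
              refine (norm_sub_le _ _).trans ?_
              rw [norm_mul, norm_mul]
              gcongr
              exact hzb t ht1
          _ = _ := by ring
    refine hmono.trans ?_
    rw [intervalIntegral.integral_add intervalIntegrable_const hki,
      intervalIntegral.integral_const]
    gcongr
    rw [sub_zero, smul_eq_mul]
    exact mul_le_of_le_one_left (by positivity) hx.2

end IsIVPSolution

/-- The slope at μ is (l + μ) J(l), so continuity of J suffices. This upgrades continuous dependence
on the parameter to analyticity. -/
theorem differentiableAt_sq_sub_sq_mul {J : ℂ → ℂ} {μ : ℂ} (hJ : ContinuousAt J μ) :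
    DifferentiableAt ℂ (fun l ↦ (l ^ 2 - μ ^ 2) * J l) μ := by
  have h : HasDerivAt (fun l ↦ (l ^ 2 - μ ^ 2) * J l) ((μ + μ) * J μ) μ := by
    rw [hasDerivAt_iff_tendsto_slope]
    have : ContinuousAt (fun l ↦ (l + μ) * J l) μ := by fun_prop
    refine (this.tendsto.mono_left nhdsWithin_le_nhds).congr' ?_
    filter_upwards [self_mem_nhdsWithin] with l hl
    have : l - μ ≠ 0 := sub_ne_zero.2 hl
    rw [slope_def_field]
    field_simp
    ring
  exact h.differentiableAt

/-- The end values of solutions are entire functions of the spectral parameter. -/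
theorem differentiable_end {q : ℝ → ℂ} (hq : IntervalIntegrable q volume 0 1) {a b : ℂ}
    {y dy yc dyc ys dys : ℂ → ℝ → ℂ} (hy : ∀ μ, IsIVPSolution q μ a b (y μ) (dy μ))
    (hc : ∀ μ, IsIVPSolution q μ 1 0 (yc μ) (dyc μ))
    (hs : ∀ μ, IsIVPSolution q μ 0 1 (ys μ) (dys μ)) :
    Differentiable ℂ (fun μ ↦ y μ 1) ∧ Differentiable ℂ (fun μ ↦ dy μ 1) := by
  have hcont : ∀ μ : ℂ, ∀ u : ℝ → ℂ, ContinuousOn u (Icc 0 1) →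
      ContinuousAt (fun l ↦ ∫ t in (0 : ℝ)..1, y l t * u t) μ := by
    intro μ u hu
    obtain ⟨K, hK⟩ := (hy μ).exists_norm_sub_le hq
    have hui : ContinuousOn u (uIcc 0 1) := by rwa [uIcc_of_le zero_le_one]
    have hlim : Tendsto (fun l : ℂ ↦ K * ‖l ^ 2 - μ ^ 2‖ * ∫ t in (0 : ℝ)..1, ‖u t‖)
        (𝓝 μ) (𝓝 0) := by
      have : Continuous (fun l : ℂ ↦ K * ‖l ^ 2 - μ ^ 2‖ * ∫ t in (0 : ℝ)..1, ‖u t‖) := by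
        fun_prop
      simpa using this.tendsto μ
    rw [ContinuousAt, tendsto_iff_norm_sub_tendsto_zero]
    refine squeeze_zero' (Eventually.of_forall fun _ ↦ norm_nonneg _) ?_ hlim
    filter_upwards [Metric.closedBall_mem_nhds μ one_pos] with l hl
    rw [mem_closedBall_iff_norm] at hl
    have hi : ∀ l, IntervalIntegrable (fun t ↦ y l t * u t) volume 0 1 := fun l ↦
      ((hy l).continuousOn_uIcc.mul hui).intervalIntegrable
    rw [← intervalIntegral.integral_sub (hi l) (hi μ),
      ← intervalIntegral.integral_const_mul]
    apply intervalIntegral.norm_integral_le_of_norm_le zero_le_one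
    · refine Eventually.of_forall fun t ht ↦ ?_
      rw [← sub_mul, norm_mul]
      gcongr
      exact hK l (y l) (dy l) (hy l) hl t (Ioc_subset_Icc_self ht)
    · exact (hui.norm.intervalIntegrable).const_mul _
  have hW : ∀ μ, yc μ 1 * dys μ 1 - dyc μ 1 * ys μ 1 = 1 := fun μ ↦ by
    simpa using (hc μ).wronskian hq (hs μ)
  refine ⟨fun μ ↦ ?_, fun μ ↦ ?_⟩
  -- For fixed μ, the Wronskian identities against y_c(·, μ) and y_s(·, μ) form a linear system for
  -- the end values at l, with determinant 1 by `hW`. Cramer's rule isolates the dependence on l in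
  -- terms (l² - μ²) J(l).
  · have e : (fun l ↦ y l 1) = fun l ↦
        yc μ 1 * (a * 1 - b * 0 + (l ^ 2 - μ ^ 2) * ∫ t in (0 : ℝ)..1, y l t * ys μ t)
        - ys μ 1 * (a * 0 - b * 1 + (l ^ 2 - μ ^ 2) * ∫ t in (0 : ℝ)..1, y l t * yc μ t) := by
      ext l
      rw [← (hy l).wronskian hq (hc μ), ← (hy l).wronskian hq (hs μ)]
      linear_combination -(y l 1) * hW μ
    rw [e]
    exact (((differentiableAt_sq_sub_sq_mul (hcont μ _ (hs μ).continuousOn)).const_add _).const_mul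
      _).sub (((differentiableAt_sq_sub_sq_mul (hcont μ _ (hc μ).continuousOn)).const_add
      _).const_mul _)
  · have e : (fun l ↦ dy l 1) = fun l ↦
        dyc μ 1 * (a * 1 - b * 0 + (l ^ 2 - μ ^ 2) * ∫ t in (0 : ℝ)..1, y l t * ys μ t)
        - dys μ 1 * (a * 0 - b * 1 + (l ^ 2 - μ ^ 2) * ∫ t in (0 : ℝ)..1, y l t * yc μ t) := by
      ext l
      rw [← (hy l).wronskian hq (hc μ), ← (hy l).wronskian hq (hs μ)]
      linear_combination -(dy l 1) * hW μ
    rw [e]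
    exact (((differentiableAt_sq_sub_sq_mul (hcont μ _ (hs μ).continuousOn)).const_add _).const_mul
      _).sub (((differentiableAt_sq_sub_sq_mul (hcont μ _ (hc μ).continuousOn)).const_add
      _).const_mul _)

/-! ### Lower bounds for the sine. -/

section Sine

theorem norm_sin_sq (z : ℂ) :
    ‖Complex.sin z‖ ^ 2 = Real.sin z.re ^ 2 + Real.sinh z.im ^ 2 := by
  have h : Complex.sin z = ((Real.sin z.re * Real.cosh z.im : ℝ) : ℂ)
      + ((Real.cos z.re * Real.sinh z.im : ℝ) : ℂ) * Complex.I := by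
    rw [Complex.sin_eq]; push_cast; ring
  rw [Complex.sq_norm, h, Complex.normSq_add_mul_I, mul_pow, mul_pow, Real.cosh_sq]
  linear_combination Real.sinh z.im ^ 2 * Real.sin_sq_add_cos_sq z.re

theorem norm_sin_sub_int_mul_pi (z : ℂ) (j : ℤ) :
    ‖Complex.sin (z - j * Real.pi)‖ = ‖Complex.sin z‖ := by
  have h : ‖Complex.sin (z - j * Real.pi)‖ ^ 2 = ‖Complex.sin z‖ ^ 2 := by
    have h1 : (z - j * Real.pi : ℂ).re = z.re - j * Real.pi := by simp
    have h2 : (z - j * Real.pi : ℂ).im = z.im := by simp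
    rw [norm_sin_sq, norm_sin_sq, h1, h2, Real.sin_sub_int_mul_pi, mul_pow, ← zpow_natCast,
      ← zpow_mul, mul_comm j, zpow_mul]
    simp
  exact (pow_left_inj₀ (norm_nonneg _) (norm_nonneg _) two_ne_zero).1 h

theorem sinh_abs_im_le_norm_sin (z : ℂ) : Real.sinh |z.im| ≤ ‖Complex.sin z‖ := by
  rw [← Real.abs_sinh]
  apply abs_le_of_sq_le_sq _ (norm_nonneg _)
  rw [norm_sin_sq]
  linarith [sq_nonneg (Real.sin z.re)]

/-- With t = |Im z| ≥ 1 one has e^{-t} ≤ 1 ≤ e^t / 2, hence sinh t ≥ e^t / 4. -/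
theorem exp_abs_im_le_norm_sin {z : ℂ} (hz : 1 ≤ |z.im|) :
    Real.exp |z.im| ≤ 4 * ‖Complex.sin z‖ := by
  have h := sinh_abs_im_le_norm_sin z
  rw [Real.sinh_eq] at h
  have h1 := Real.add_one_le_exp |z.im|
  have h2 : Real.exp (-|z.im|) ≤ 1 := Real.exp_le_one_iff.2 (by linarith)
  linarith

/-- Jordan's inequality handles the real part and |y| ≤ |sinh y| the imaginary part; the two
recombine in |sin w|² = sin² x + sinh² y. -/
theorem norm_le_norm_sin {w : ℂ} (hw : |w.re| ≤ Real.pi / 2) :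
    ‖w‖ ≤ Real.pi / 2 * ‖Complex.sin w‖ := by
  have hpi := Real.pi_pos
  refine (abs_le_of_sq_le_sq' ?_ (by positivity)).2
  have h1 := Real.mul_abs_le_abs_sin hw
  have h2 : |w.im| ≤ Real.sinh |w.im| := Real.self_le_sinh_iff.2 (abs_nonneg _)
  rw [← Real.abs_sinh] at h2
  have h3 : |w.re| ≤ Real.pi / 2 * |Real.sin w.re| := by
    calc |w.re| = Real.pi / 2 * (2 / Real.pi * |w.re|) := by field_simp
      _ ≤ _ := by gcongr
  have h4 : w.re ^ 2 ≤ (Real.pi / 2) ^ 2 * Real.sin w.re ^ 2 := by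
    rw [← mul_pow]
    apply sq_le_sq.2
    rwa [abs_mul, abs_of_pos (by positivity : 0 < Real.pi / 2)]
  have h5 : w.im ^ 2 ≤ Real.sinh w.im ^ 2 := sq_le_sq.2 h2
  have h6 : (1 : ℝ) ≤ (Real.pi / 2) ^ 2 := by
    have : 1 ≤ Real.pi / 2 := by linarith [Real.two_le_pi]
    exact one_le_pow₀ this
  rw [mul_pow, norm_sin_sq, Complex.sq_norm, Complex.normSq_apply, mul_add]
  have h7 : Real.sinh w.im ^ 2 ≤ (Real.pi / 2) ^ 2 * Real.sinh w.im ^ 2 :=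
    le_mul_of_one_le_left (sq_nonneg _) h6
  linarith

end Sine

/-! ### Entire functions that vanish at the zeros of the sine. -/

section Quotient

variable {H : ℂ → ℂ} {C : ℝ}

theorem norm_deriv_le_of_exp_type (hH : Differentiable ℂ H)
    (hb : ∀ z, ‖H z‖ ≤ C * Real.exp |z.im|) {z : ℂ} (hz : |z.im| ≤ 1) :
    ‖deriv H z‖ ≤ C * Real.exp 2 := by
  have hC : 0 ≤ C := by simpa using (norm_nonneg _).trans (hb 0)
  have := Complex.norm_deriv_le_of_forall_mem_sphere_norm_le (c := z) one_pos
    hH.diffContOnCl (C := C * Real.exp 2) (fun w hw ↦ ?_)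
  · simpa using this
  · refine (hb w).trans ?_
    gcongr
    rw [mem_sphere_iff_norm] at hw
    have h2 := (Complex.abs_im_le_norm (w - z)).trans hw.le
    rw [Complex.sub_im] at h2
    linarith [abs_sub_abs_le_abs_sub w.im z.im]

theorem norm_le_mul_norm_sin (hH : Differentiable ℂ H)
    (hb : ∀ z, ‖H z‖ ≤ C * Real.exp |z.im|) (h0 : ∀ j : ℤ, H (j * Real.pi) = 0) (z : ℂ) :
    ‖H z‖ ≤ (4 * C + C * Real.exp 2 * (Real.pi / 2)) * ‖Complex.sin z‖ := by
  have hC : 0 ≤ C := by simpa using (norm_nonneg _).trans (hb 0)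
  have hpi := Real.pi_pos
  rcases le_total 1 |z.im| with hz | hz
  · calc ‖H z‖ ≤ C * Real.exp |z.im| := hb z
      _ ≤ C * (4 * ‖Complex.sin z‖) := by gcongr; exact exp_abs_im_le_norm_sin hz
      _ = 4 * C * ‖Complex.sin z‖ := by ring
      _ ≤ _ := by
        gcongr
        have : 0 ≤ C * Real.exp 2 * (Real.pi / 2) := by positivity
        linarith
  -- Near the real axis H is controlled by its derivative and the distance to the nearest node, a
  -- distance comparable to |sin z|.
  · set j : ℤ := round (z.re / Real.pi) with hj
    have hw : |(z - j * Real.pi : ℂ).re| ≤ Real.pi / 2 := by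
      have h1 := abs_sub_round (z.re / Real.pi)
      have h2 : (z - j * Real.pi : ℂ).re = (z.re / Real.pi - j) * Real.pi := by
        simp; field_simp
      rw [h2, abs_mul, abs_of_pos hpi]
      calc _ ≤ 1 / 2 * Real.pi := by gcongr
        _ = _ := by ring
    have hconv : Convex ℝ {w : ℂ | |w.im| ≤ 1} := by
      have : {w : ℂ | |w.im| ≤ 1} = Complex.imLm ⁻¹' Icc (-1) 1 := by
        ext w; simp [abs_le]
      rw [this]
      exact (convex_Icc _ _).linear_preimage _
    have hj0 : (j * Real.pi : ℂ) ∈ {w : ℂ | |w.im| ≤ 1} := by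
      change |(j * Real.pi : ℂ).im| ≤ 1
      simp
    have key := hconv.norm_image_sub_le_of_norm_deriv_le (fun w _ ↦ hH w)
      (fun w hw ↦ norm_deriv_le_of_exp_type hH hb hw) hj0 hz
    rw [h0 j, sub_zero] at key
    calc ‖H z‖ ≤ C * Real.exp 2 * ‖z - j * Real.pi‖ := key
      _ ≤ C * Real.exp 2 * (Real.pi / 2 * ‖Complex.sin z‖) := by
        gcongr
        rw [← norm_sin_sub_int_mul_pi z j]
        exact norm_le_norm_sin hw
      _ = C * Real.exp 2 * (Real.pi / 2) * ‖Complex.sin z‖ := by ring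
      _ ≤ _ := by
        gcongr
        linarith

theorem norm_cos_eq_one_of_sin_eq_zero {z : ℂ} (h : Complex.sin z = 0) :
    ‖Complex.cos z‖ = 1 := by
  have h1 := Complex.sin_sq_add_cos_sq z
  rw [h] at h1
  have h2 : ‖Complex.cos z‖ ^ 2 = 1 := by
    rw [← norm_pow]; rw [show Complex.cos z ^ 2 = 1 by simpa using h1]; simp
  exact (pow_eq_one_iff_of_nonneg (norm_nonneg _) two_ne_zero).1 h2

/-- An entire function of exponential type `1`, bounded on the real line, that vanishes at the
points `jπ`, is a multiple of the sine. -/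
theorem exists_eq_mul_sin (hH : Differentiable ℂ H)
    (hb : ∀ z, ‖H z‖ ≤ C * Real.exp |z.im|) (h0 : ∀ j : ℤ, H (j * Real.pi) = 0) :
    ∃ c : ℂ, ∀ z, H z = c * Complex.sin z := by
  classical
  have hC : 0 ≤ C := by simpa using (norm_nonneg _).trans (hb 0)
  have hz0 : ∀ z, Complex.sin z = 0 → H z = 0 := by
    intro z hz
    obtain ⟨k, rfl⟩ := Complex.sin_eq_zero_iff.1 hz
    exact h0 k
  -- The quotient H / sin with its removable singularities filled in by l'Hôpital's rule; it is
  -- entire and bounded, so Liouville applies.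
  set G : ℂ → ℂ := fun z ↦ if Complex.sin z = 0 then deriv H z / Complex.cos z
    else H z / Complex.sin z with hG
  have hGd : Differentiable ℂ G := by
    intro a
    by_cases ha : Complex.sin a = 0
    · have hd1 : DifferentiableAt ℂ (dslope H a) a :=
        ((Complex.differentiableOn_dslope univ_mem).2 hH.differentiableOn a
          (mem_univ a)).differentiableAt univ_mem
      have hd2 : DifferentiableAt ℂ (dslope Complex.sin a) a :=
        ((Complex.differentiableOn_dslope univ_mem).2 Complex.differentiable_sin.differentiableOn a
          (mem_univ a)).differentiableAt univ_mem
      have hcos : Complex.cos a ≠ 0 := by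
        rw [← norm_ne_zero_iff, norm_cos_eq_one_of_sin_eq_zero ha]; exact one_ne_zero
      have hne : dslope Complex.sin a a ≠ 0 := by
        rwa [dslope_same, Complex.deriv_sin]
      refine (hd1.div hd2 hne).congr_of_eventuallyEq ?_
      filter_upwards [hd2.continuousAt.eventually_ne hne] with z hz
      by_cases hza : z = a
      · subst hza
        simp [hG, ha]
      · have hsz : dslope Complex.sin a z = Complex.sin z / (z - a) := by
          rw [dslope_of_ne _ hza, slope_def_field, ha, sub_zero]
        have hHz : dslope H a z = H z / (z - a) := by
          rw [dslope_of_ne _ hza, slope_def_field, hz0 a ha, sub_zero]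
        have hsub : z - a ≠ 0 := sub_ne_zero.2 hza
        have hs : Complex.sin z ≠ 0 := by
          intro h
          rw [hsz, h, zero_div] at hz
          exact hz rfl
        rw [Pi.div_apply, hsz, hHz]
        simp only [hG, hs, if_false]
        field_simp
    · refine ((hH a).div (Complex.differentiable_sin a) ha).congr_of_eventuallyEq ?_
      filter_upwards [Complex.continuous_sin.continuousAt.eventually_ne ha] with z hz
      simp [hG, hz]
  have hGb : ∀ z, ‖G z‖ ≤ 4 * C + C * Real.exp 2 * (Real.pi / 2) + C * Real.exp 2 := by
    intro z
    have hp1 : 0 ≤ C * Real.exp 2 * (Real.pi / 2) := by positivity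
    have hp2 : 0 ≤ C * Real.exp 2 := by positivity
    by_cases hz : Complex.sin z = 0
    · have him : |z.im| ≤ 1 := by
        obtain ⟨k, rfl⟩ := Complex.sin_eq_zero_iff.1 hz
        simp
      simp only [hG, hz, if_true]
      rw [norm_div, norm_cos_eq_one_of_sin_eq_zero hz, div_one]
      linarith [norm_deriv_le_of_exp_type hH hb him]
    · simp only [hG, hz, if_false]
      rw [norm_div, div_le_iff₀ (norm_pos_iff.2 hz)]
      refine (norm_le_mul_norm_sin hH hb h0 z).trans ?_
      exact mul_le_mul_of_nonneg_right (by linarith) (norm_nonneg _)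
  refine ⟨G 0, fun z ↦ ?_⟩
  have hconst : G z = G 0 := hGd.apply_eq_apply_of_bounded
    (isBounded_iff_forall_norm_le.2 ⟨_, by rintro _ ⟨w, rfl⟩; exact hGb w⟩) z 0
  rw [← hconst]
  by_cases hz : Complex.sin z = 0
  · rw [hz, mul_zero, hz0 z hz]
  · simp only [hG, hz, if_false]
    field_simp

/-- If moreover `H(iy) = o(e^y)`, then `H` vanishes. -/
theorem eq_zero_of_tendsto (hH : Differentiable ℂ H)
    (hb : ∀ z, ‖H z‖ ≤ C * Real.exp |z.im|) (h0 : ∀ j : ℤ, H (j * Real.pi) = 0)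
    (hlim : Tendsto (fun t : ℝ ↦ ‖H (t * Complex.I)‖ * Real.exp (-t)) atTop (𝓝 0)) (z : ℂ) :
    H z = 0 := by
  obtain ⟨c, hc⟩ := exists_eq_mul_sin hH hb h0
  -- Since |sin(it)| ≥ e^t / 4 for t ≥ 1, a nonzero multiple of the sine cannot be o(e^t) on the
  -- imaginary axis.
  have h1 : ∀ᶠ t : ℝ in atTop, ‖c‖ / 4 ≤ ‖H (t * Complex.I)‖ * Real.exp (-t) := by
    filter_upwards [eventually_ge_atTop 1] with t ht
    have h2 := exp_abs_im_le_norm_sin (z := t * Complex.I) (by simpa using ht.trans (le_abs_self t))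
    have h3 : |((t : ℂ) * Complex.I).im| = t := by simpa using zero_le_one.trans ht
    rw [h3] at h2
    rw [hc, norm_mul, Real.exp_neg, ← div_eq_mul_inv, le_div_iff₀ (Real.exp_pos t)]
    calc ‖c‖ / 4 * Real.exp t ≤ ‖c‖ / 4 * (4 * ‖Complex.sin (t * Complex.I)‖) := by gcongr
      _ = _ := by ring
  have h2 : ‖c‖ / 4 ≤ 0 := ge_of_tendsto hlim h1
  have h3 : c = 0 := by
    rw [← norm_le_zero_iff]; linarith
  rw [hc, h3, zero_mul]

end Quotient

/-! ### The cardinal series. -/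

section Cardinal

theorem csinc_int_mul_pi {k : ℤ} (hk : k ≠ 0) : csinc (k * Real.pi) = 0 := by
  have h : (k * Real.pi : ℂ) ≠ 0 := by
    simp [hk, Real.pi_ne_zero]
  rw [csinc, if_neg h, Complex.sin_int_mul_pi, zero_div]

theorem norm_csinc_mul_le (z : ℂ) : ‖z‖ * ‖csinc z‖ ≤ Real.exp |z.im| := by
  rw [← norm_mul, mul_csinc]; exact norm_sin_le z

/-- The Whittaker–Shannon cardinal series, with nodes `jπ`. -/
theorem hasSum_cardinal {f : ℂ → ℂ} {C : ℝ} (hf : Differentiable ℂ f)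
    (hb : ∀ z, ‖f z‖ ≤ C * Real.exp |z.im|) (hsum : Summable fun j : ℤ ↦ ‖f (j * Real.pi)‖)
    (hlim : Tendsto (fun t : ℝ ↦ ‖f (t * Complex.I)‖ * Real.exp (-t)) atTop (𝓝 0)) (z : ℂ) :
    HasSum (fun j : ℤ ↦ f (j * Real.pi) * csinc (z - j * Real.pi)) (f z) := by
  have him : ∀ (z : ℂ) (j : ℤ), (z - j * Real.pi : ℂ).im = z.im := by simp
  have hterm : ∀ (z : ℂ) (j : ℤ), ‖f (j * Real.pi) * csinc (z - j * Real.pi)‖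
      ≤ ‖f (j * Real.pi)‖ * Real.exp |z.im| := by
    intro z j
    rw [norm_mul]
    gcongr
    have := norm_csinc_le (z - j * Real.pi)
    rwa [him] at this
  have hs : ∀ z : ℂ, Summable fun j : ℤ ↦ f (j * Real.pi) * csinc (z - j * Real.pi) := fun z ↦
    Summable.of_norm_bounded (hsum.mul_right _) (hterm z)
  set S : ℂ → ℂ := fun z ↦ ∑' j : ℤ, f (j * Real.pi) * csinc (z - j * Real.pi) with hS
  set A := ∑' j : ℤ, ‖f (j * Real.pi)‖ with hA
  have hSb : ∀ z, ‖S z‖ ≤ A * Real.exp |z.im| := fun z ↦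
    tsum_of_norm_bounded (hsum.hasSum.mul_right _) (hterm z)
  have hSd : Differentiable ℂ S := by
    intro z
    have hopen : IsOpen {w : ℂ | |w.im| < |z.im| + 1} :=
      isOpen_lt (by fun_prop) continuous_const
    have hd := Complex.differentiableOn_tsum_of_summable_norm (U := {w : ℂ | |w.im| < |z.im| + 1})
      (F := fun (j : ℤ) w ↦ f (j * Real.pi) * csinc (w - j * Real.pi))
      (hsum.mul_right (Real.exp (|z.im| + 1)))
      (fun j ↦ ((differentiable_csinc.comp (differentiable_id.sub_const _)).const_mul
        _).differentiableOn)
      hopen (fun j w hw ↦ (hterm w j).trans (by gcongr; exact le_of_lt hw))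
    exact (hd z (show |z.im| < |z.im| + 1 by linarith)).differentiableAt
      (hopen.mem_nhds (show |z.im| < |z.im| + 1 by linarith))
  have hSn : ∀ k : ℤ, S (k * Real.pi) = f (k * Real.pi) := by
    intro k
    rw [hS]
    dsimp only
    rw [tsum_eq_single k]
    · simp [csinc]
    · intro j hj
      have : (k * Real.pi - j * Real.pi : ℂ) = ((k - j : ℤ) : ℂ) * Real.pi := by
        push_cast; ring
      rw [this, csinc_int_mul_pi (sub_ne_zero.2 (Ne.symm hj)), mul_zero]
  -- Every node is at distance at least t from it, so each sinc is at most e^t / t there, uniformly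
  -- in the node.
  have hSlim : Tendsto (fun t : ℝ ↦ ‖S (t * Complex.I)‖ * Real.exp (-t)) atTop (𝓝 0) := by
    have h1 : Tendsto (fun t : ℝ ↦ A * t⁻¹) atTop (𝓝 0) := by
      simpa using tendsto_inv_atTop_zero.const_mul A
    refine squeeze_zero' (Eventually.of_forall fun t ↦ by positivity) ?_ h1
    filter_upwards [eventually_gt_atTop 0] with t ht
    have h2 : ‖S (t * Complex.I)‖ ≤ A * (Real.exp t * t⁻¹) := by
      refine tsum_of_norm_bounded (hsum.hasSum.mul_right _) (fun j ↦ ?_)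
      rw [norm_mul]
      gcongr
      have h3 := norm_csinc_mul_le (t * Complex.I - j * Real.pi)
      rw [him] at h3
      have h4 := Complex.abs_im_le_norm (t * Complex.I - j * Real.pi)
      rw [him] at h4
      have h5 : |((t : ℂ) * Complex.I).im| = t := by simpa using ht.le
      rw [h5] at h3 h4
      rw [← div_eq_mul_inv, le_div_iff₀ ht, mul_comm]
      exact (mul_le_mul_of_nonneg_right h4 (norm_nonneg _)).trans h3
    calc _ ≤ A * (Real.exp t * t⁻¹) * Real.exp (-t) := by gcongr
      _ = A * t⁻¹ * (Real.exp t * Real.exp (-t)) := by ring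
      _ = A * t⁻¹ := by rw [← Real.exp_add]; simp
  have key := eq_zero_of_tendsto (H := fun z ↦ f z - S z) (C := C + A) (hf.sub hSd)
    (fun z ↦ (norm_sub_le _ _).trans (by rw [add_mul]; exact add_le_add (hb z) (hSb z)))
    (fun j ↦ by rw [hSn, sub_self]) ?_ z
  · rw [sub_eq_zero.1 key]
    exact (hs z).hasSum
  · have := hlim.add hSlim
    rw [add_zero] at this
    refine squeeze_zero (fun t ↦ by positivity) (fun t ↦ ?_) this
    rw [← add_mul]
    gcongr
    exact norm_sub_le _ _

end Cardinal

/-! ### Truncation error of the cardinal series. -/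

section Truncation

/-- Both |P - μ| and δ are at most |P + δ - μ|, because Re μ < P; hence so is their geometric mean.
One square root goes into the bracket T_N, the other makes the tail summable. -/
theorem one_div_norm_le {P δ : ℝ} {μ : ℂ} (hδ : 0 < δ) (hμ : ‖μ‖ < P) :
    1 / ‖((P + δ : ℝ) : ℂ) - μ‖ ≤ 1 / √‖(P : ℂ) - μ‖ * (1 / √δ) := by
  have hre : μ.re ≤ ‖μ‖ := Complex.re_le_norm μ
  have hP : 0 < ‖(P : ℂ) - μ‖ := by
    have h := Complex.re_le_norm ((P : ℂ) - μ)
    simp only [Complex.sub_re, Complex.ofReal_re] at h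
    linarith
  have h1 : ‖(P : ℂ) - μ‖ ≤ ‖((P + δ : ℝ) : ℂ) - μ‖ := by
    refine (abs_le_of_sq_le_sq' ?_ (norm_nonneg _)).2
    rw [Complex.sq_norm, Complex.sq_norm, Complex.normSq_apply, Complex.normSq_apply]
    simp only [Complex.sub_re, Complex.sub_im, Complex.ofReal_re, Complex.ofReal_im]
    nlinarith
  have h2 : δ ≤ ‖((P + δ : ℝ) : ℂ) - μ‖ := by
    have h := Complex.re_le_norm (((P + δ : ℝ) : ℂ) - μ)
    simp only [Complex.sub_re, Complex.ofReal_re] at h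
    linarith
  rw [one_div_mul_one_div]
  apply one_div_le_one_div_of_le (by positivity)
  calc √‖(P : ℂ) - μ‖ * √δ ≤ √‖((P + δ : ℝ) : ℂ) - μ‖ * √‖((P + δ : ℝ) : ℂ) - μ‖ := by gcongr
    _ = _ := Real.mul_self_sqrt (norm_nonneg _)

theorem sum_Icc_neg_eq (a : ℤ → ℂ) (N : ℕ) :
    ∑ j ∈ Finset.Icc (-(N : ℤ)) N, a j = ∑ n ∈ Finset.range (N + 1), (a n + a (-n)) - a 0 := by
  induction N with
  | zero => simp
  | succ N ih =>
    rw [Finset.sum_range_succ, Nat.cast_succ, Finset.Icc_succ_succ, Finset.sum_union (by simp),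
      ih, Finset.sum_pair (by omega)]
    ring

theorem summable_one_div_mul_sqrt :
    Summable fun i : ℕ ↦ 1 / ((i : ℝ) + 1) * (1 / √((i : ℝ) + 1)) := by
  have h := (summable_nat_add_iff 1).2
    (Real.summable_one_div_nat_rpow.2 (by norm_num : (1 : ℝ) < 3 / 2))
  refine h.congr fun i ↦ ?_
  have hi : (0 : ℝ) < (i : ℝ) + 1 := by positivity
  rw [one_div_mul_one_div, Nat.cast_add, Nat.cast_one, Real.sqrt_eq_rpow,
    show (3 / 2 : ℝ) = 1 + 1 / 2 by norm_num, Real.rpow_add hi, Real.rpow_one]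

variable {h : ℂ → ℂ} {C σ : ℝ} {m : ℕ}

theorem hasSum_cardinal_scaled (hσ : 0 < σ) (hh : Differentiable ℂ h)
    (hb : ∀ z, ‖h z‖ ≤ C * Real.exp (σ * |z.im|))
    (hsum : Summable fun j : ℤ ↦ ‖h ((j * Real.pi / σ : ℝ) : ℂ)‖)
    (hlim : Tendsto (fun t : ℝ ↦ ‖h (t * Complex.I)‖ * Real.exp (-(σ * t))) atTop (𝓝 0)) (μ : ℂ) :
    HasSum (fun j : ℤ ↦ h ((j * Real.pi / σ : ℝ) : ℂ)
      * csinc (σ * (μ - ((j * Real.pi / σ : ℝ) : ℂ)))) (h μ) := by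
  have hσ' : (σ : ℂ) ≠ 0 := by exact_mod_cast hσ.ne'
  have hnode : ∀ j : ℤ, ((j * Real.pi / σ : ℝ) : ℂ) = (j * Real.pi : ℂ) / σ := fun j ↦ by
    push_cast; ring
  have key := hasSum_cardinal (f := fun z ↦ h (z / σ)) (C := C)
    (hh.comp (differentiable_id.div_const _)) (fun z ↦ ?_) ?_ ?_ (σ * μ)
  · simp only [mul_div_cancel_left₀ μ hσ'] at key
    refine key.congr_fun fun j ↦ ?_
    rw [hnode, mul_sub, mul_div_cancel₀ _ hσ']
  · refine (hb _).trans (le_of_eq ?_)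
    rw [Complex.div_ofReal_im, abs_div, abs_of_pos hσ, mul_div_cancel₀ _ hσ.ne']
  · refine hsum.congr fun j ↦ ?_
    rw [hnode]
  · have h1 : Tendsto (fun t : ℝ ↦ t / σ) atTop atTop := tendsto_id.atTop_div_const hσ
    refine (hlim.comp h1).congr fun t ↦ ?_
    simp only [Function.comp_apply]
    rw [mul_div_cancel₀ _ hσ.ne', Complex.ofReal_div, div_mul_eq_mul_div]

theorem summable_norm_nodes (hσ : 0 < σ) (hm : 2 ≤ m)
    (hdec : ∀ x : ℝ, |x| ^ m * ‖h x‖ ≤ C) :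
    Summable fun j : ℤ ↦ ‖h ((j * Real.pi / σ : ℝ) : ℂ)‖ := by
  have hpi := Real.pi_pos
  have hs : Summable fun j : ℤ ↦ (C / (Real.pi / σ) ^ m) * |1 / (j : ℝ) ^ m| :=
    ((Real.summable_one_div_int_pow.2 (by omega : 1 < m)).abs).mul_left _
  refine Summable.of_norm_bounded_eventually hs ?_
  have : ∀ᶠ j : ℤ in cofinite, j ≠ 0 := by
    simpa using (Set.finite_singleton (0 : ℤ)).compl_mem_cofinite
  filter_upwards [this] with j hj
  have hj' : 0 < |(j : ℝ)| := abs_pos.2 (by exact_mod_cast hj)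
  have h1 := hdec (j * Real.pi / σ)
  rw [norm_norm, abs_div, abs_one, abs_pow, div_mul_div_comm, mul_one,
    le_div_iff₀ (by positivity), mul_comm]
  refine le_trans (le_of_eq ?_) h1
  have h2 : |(j * Real.pi / σ : ℝ)| = |(j : ℝ)| * (Real.pi / σ) := by
    rw [abs_div, abs_mul, abs_of_pos hpi, abs_of_pos hσ, mul_div_assoc]
  rw [h2, mul_pow]
  ring

/-- The truncation error of the cardinal series of a function that decays like `|x|^{-m}`. -/
theorem exists_truncCardinal_error (hσ : 0 < σ) (hm : 2 ≤ m) (hh : Differentiable ℂ h)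
    (hb : ∀ z, ‖h z‖ ≤ C * Real.exp (σ * |z.im|)) (hdec : ∀ x : ℝ, |x| ^ m * ‖h x‖ ≤ C)
    (hlim : Tendsto (fun t : ℝ ↦ ‖h (t * Complex.I)‖ * Real.exp (-(σ * t))) atTop (𝓝 0)) :
    ∃ K : ℝ, 0 ≤ K ∧ (∀ (N : ℕ) (μ : ℂ), ‖μ‖ < N * Real.pi / σ →
      ‖h μ - truncCardinal σ N h μ‖ ≤ K * ‖Complex.sin (σ * μ)‖ *
        (1 / √‖((N * Real.pi / σ : ℝ) : ℂ) - μ‖ + 1 / √‖((N * Real.pi / σ : ℝ) : ℂ) + μ‖)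
        * (1 / ((N : ℝ) + 1) ^ (m - 1))) ∧
      ∀ (N : ℕ) (μ : ℂ), ‖h μ - truncCardinal σ N h μ‖ ≤ K * Real.exp (σ * |μ.im|) := by
  have hpi := Real.pi_pos
  have hC : 0 ≤ C := by simpa using (norm_nonneg _).trans (hb 0)
  have hsum := summable_norm_nodes hσ hm hdec
  set A := ∑' j : ℤ, ‖h ((j * Real.pi / σ : ℝ) : ℂ)‖ with hA
  have hA0 : 0 ≤ A := tsum_nonneg fun _ ↦ norm_nonneg _
  set R := ∑' i : ℕ, 1 / ((i : ℝ) + 1) * (1 / √((i : ℝ) + 1)) with hR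
  have hR0 : 0 ≤ R := tsum_nonneg fun _ ↦ by positivity
  set C₁ := C / (Real.pi / σ) ^ m / σ * (1 / √(Real.pi / σ)) with hC₁
  have hC₁0 : 0 ≤ C₁ := by positivity
  -- The part C₁ R serves the tail estimate, the part C + A the crude bound valid at every μ.
  refine ⟨C₁ * R + (C + A), by positivity, fun N μ hμ ↦ ?_, fun N μ ↦ ?_⟩
  · set P := N * Real.pi / σ with hP
    set a : ℤ → ℂ := fun j ↦ h ((j * Real.pi / σ : ℝ) : ℂ)
      * csinc (σ * (μ - ((j * Real.pi / σ : ℝ) : ℂ))) with ha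
    have hN1 : 0 < ((N : ℝ) + 1) ^ (m - 1) := by positivity
    -- Folding the series over ±n counts the term at 0 twice, in the full sum and in the partial sum
    -- alike, so the extra copy cancels.
    have hbase : HasSum (fun i : ℕ ↦ a ((i + (N + 1) : ℕ) : ℤ) + a (-((i + (N + 1) : ℕ) : ℤ)))
        (h μ - truncCardinal σ N h μ) := by
      have h1 := (hasSum_nat_add_iff' (N + 1)).2
        (hasSum_cardinal_scaled hσ hh hb hsum hlim μ).nat_add_neg
      have h2 := sum_Icc_neg_eq a N
      have h3 : truncCardinal σ N h μ = ∑ j ∈ Finset.Icc (-(N : ℤ)) N, a j := rfl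
      have h4 : h μ - (∑ n ∈ Finset.range (N + 1), (a n + a (-n)) - a 0)
          = h μ + a 0 - ∑ n ∈ Finset.range (N + 1), (a n + a (-n)) := by ring
      rw [h3, h2, h4]
      exact h1
    -- a bound for a single term
    have hterm : ∀ (i : ℕ) (j : ℤ) (ν : ℂ), |(j : ℝ)| = ((i + (N + 1) : ℕ) : ℝ) → ‖ν‖ < P →
        ‖μ - ((j * Real.pi / σ : ℝ) : ℂ)‖
          = ‖((P + (i + 1) * (Real.pi / σ) : ℝ) : ℂ) - ν‖ →
        ‖a j‖ ≤ C₁ * ‖Complex.sin (σ * μ)‖ * (1 / √‖(P : ℂ) - ν‖) * (1 / ((N : ℝ) + 1) ^ (m - 1))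
          * (1 / ((i : ℝ) + 1) * (1 / √((i : ℝ) + 1))) := by
      intro i j ν hj hν hdist
      have hi : (0 : ℝ) < (i : ℝ) + 1 := by positivity
      set δ := ((i : ℝ) + 1) * (Real.pi / σ) with hδ
      have hδ0 : 0 < δ := by positivity
      have h1 := one_div_norm_le hδ0 hν
      rw [← hdist] at h1
      have hpos : 0 < ‖μ - ((j * Real.pi / σ : ℝ) : ℂ)‖ := by
        rw [hdist]
        have h := Complex.re_le_norm (((P + δ : ℝ) : ℂ) - ν)
        simp only [Complex.sub_re, Complex.ofReal_re] at h
        linarith [Complex.re_le_norm ν]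
      have hjpos : 0 < |(j : ℝ)| := by rw [hj]; positivity
      -- decay at the node
      have h2 : ‖h ((j * Real.pi / σ : ℝ) : ℂ)‖ ≤
          C / (Real.pi / σ) ^ m * (1 / ((N : ℝ) + 1) ^ (m - 1)) * (1 / ((i : ℝ) + 1)) := by
        have h3 := hdec (j * Real.pi / σ)
        have h4 : |(j * Real.pi / σ : ℝ)| = |(j : ℝ)| * (Real.pi / σ) := by
          rw [abs_div, abs_mul, abs_of_pos hpi, abs_of_pos hσ, mul_div_assoc]
        rw [h4, mul_pow] at h3
        -- Of the m factors |j| = i + N + 1, all but one are bounded below by N + 1 and the last by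
        -- i + 1. With the square root from the distance, the series in i converges like Σ i^{-3/2}.
        have h5 : ((N : ℝ) + 1) ^ (m - 1) * ((i : ℝ) + 1) ≤ |(j : ℝ)| ^ m := by
          have h6 : |(j : ℝ)| ^ m = |(j : ℝ)| ^ (m - 1) * |(j : ℝ)| := by
            rw [← pow_succ]; congr 1; omega
          rw [h6, hj]
          have hi0 : (0 : ℝ) ≤ i := Nat.cast_nonneg i
          have hN0 : (0 : ℝ) ≤ N := Nat.cast_nonneg N
          push_cast
          exact mul_le_mul (pow_le_pow_left₀ (by positivity) (by linarith) _) (by linarith)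
            hi.le (by positivity)
        have h7 : C / (Real.pi / σ) ^ m * (1 / ((N : ℝ) + 1) ^ (m - 1)) * (1 / ((i : ℝ) + 1))
            = C / ((((N : ℝ) + 1) ^ (m - 1) * ((i : ℝ) + 1)) * (Real.pi / σ) ^ m) := by
          field_simp
        rw [h7, le_div_iff₀ (by positivity), mul_comm]
        refine le_trans ?_ h3
        gcongr
      -- the sinc factor
      have h8 : ‖csinc (σ * (μ - ((j * Real.pi / σ : ℝ) : ℂ)))‖ =
          ‖Complex.sin (σ * μ)‖ / σ * (1 / ‖μ - ((j * Real.pi / σ : ℝ) : ℂ)‖) := by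
        have hσ' : (σ : ℂ) ≠ 0 := by exact_mod_cast hσ.ne'
        have h9 := congrArg norm (mul_csinc (σ * (μ - ((j * Real.pi / σ : ℝ) : ℂ))))
        have h10 : σ * (μ - ((j * Real.pi / σ : ℝ) : ℂ)) = σ * μ - j * Real.pi := by
          push_cast; field_simp
        rw [norm_mul, norm_mul, Complex.norm_real, Real.norm_of_nonneg hσ.le] at h9
        nth_rewrite 2 [h10] at h9
        rw [norm_sin_sub_int_mul_pi] at h9
        rw [← h9]
        field_simp
      have h11 : √δ = √((i : ℝ) + 1) * √(Real.pi / σ) := Real.sqrt_mul hi.le _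
      rw [h11] at h1
      calc ‖a j‖ = ‖h ((j * Real.pi / σ : ℝ) : ℂ)‖ *
            (‖Complex.sin (σ * μ)‖ / σ * (1 / ‖μ - ((j * Real.pi / σ : ℝ) : ℂ)‖)) := by
            simp only [ha]; rw [norm_mul, h8]
        _ ≤ (C / (Real.pi / σ) ^ m * (1 / ((N : ℝ) + 1) ^ (m - 1)) * (1 / ((i : ℝ) + 1))) *
            (‖Complex.sin (σ * μ)‖ / σ *
              (1 / √‖(P : ℂ) - ν‖ * (1 / (√((i : ℝ) + 1) * √(Real.pi / σ))))) := by
            gcongr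
        _ = _ := by
            rw [hC₁, ← one_div_mul_one_div]
            ring
    set T := 1 / √‖(P : ℂ) - μ‖ + 1 / √‖(P : ℂ) + μ‖ with hT
    have hbound := hbase.norm_le_of_bounded (summable_one_div_mul_sqrt.hasSum.mul_left
      (C₁ * ‖Complex.sin (σ * μ)‖ * T * (1 / ((N : ℝ) + 1) ^ (m - 1)))) (fun i ↦ ?_)
    · rw [← hR] at hbound
      refine hbound.trans ?_
      calc _ = C₁ * R * ‖Complex.sin (σ * μ)‖ * T * (1 / ((N : ℝ) + 1) ^ (m - 1)) := by ring
        _ ≤ _ := by gcongr; linarith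
    · have hj1 : |(((i + (N + 1) : ℕ) : ℤ) : ℝ)| = ((i + (N + 1) : ℕ) : ℝ) := by
        rw [Int.cast_natCast, Nat.abs_cast]
      have hnode : (((i + (N + 1) : ℕ) : ℤ) * Real.pi / σ : ℝ) = P + (i + 1) * (Real.pi / σ) := by
        rw [hP]; push_cast; ring
      have t1 := hterm i ((i + (N + 1) : ℕ) : ℤ) μ hj1 hμ (by rw [hnode, norm_sub_rev])
      have t2 := hterm i (-((i + (N + 1) : ℕ) : ℤ)) (-μ) (by rw [Int.cast_neg, abs_neg, hj1])
        (by rwa [norm_neg]) (by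
          rw [Int.cast_neg, neg_mul, neg_div, hnode, Complex.ofReal_neg]
          congr 1; ring)
      rw [sub_neg_eq_add] at t2
      refine (norm_add_le _ _).trans ((add_le_add t1 t2).trans (le_of_eq ?_))
      rw [hT]; ring
  · have h1 : ‖truncCardinal σ N h μ‖ ≤ A * Real.exp (σ * |μ.im|) := by
      rw [truncCardinal]
      refine (norm_sum_le _ _).trans ?_
      calc _ ≤ ∑ j ∈ Finset.Icc (-(N : ℤ)) N,
            ‖h ((j * Real.pi / σ : ℝ) : ℂ)‖ * Real.exp (σ * |μ.im|) := by
            refine Finset.sum_le_sum fun j _ ↦ ?_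
            rw [norm_mul]
            gcongr
            refine (norm_csinc_le _).trans (le_of_eq ?_)
            rw [Complex.im_ofReal_mul, Complex.sub_im, Complex.ofReal_im, sub_zero, abs_mul,
              abs_of_pos hσ]
        _ = (∑ j ∈ Finset.Icc (-(N : ℤ)) N, ‖h ((j * Real.pi / σ : ℝ) : ℂ)‖)
            * Real.exp (σ * |μ.im|) := by rw [Finset.sum_mul]
        _ ≤ _ := by
            gcongr
            exact hsum.sum_le_tsum _ (fun _ _ ↦ norm_nonneg _)
    calc _ ≤ C * Real.exp (σ * |μ.im|) + A * Real.exp (σ * |μ.im|) :=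
          (norm_sub_le _ _).trans (add_le_add (hb μ) h1)
      _ = (C + A) * Real.exp (σ * |μ.im|) := by ring
      _ ≤ _ := by
          have := mul_nonneg hC₁0 hR0
          exact mul_le_mul_of_nonneg_right (by linarith) (Real.exp_pos _).le

end Truncation

/-! ### Distance to a zero of order n. -/

section Zeros

theorem norm_one_add_mul_sq (ρ : ℝ) (z : ℂ) :
    ‖1 + (ρ : ℂ) * z‖ ^ 2 = 1 + ρ * (2 * z.re + ρ * ‖z‖ ^ 2) := by
  rw [Complex.sq_norm, Complex.sq_norm, Complex.normSq_apply, Complex.normSq_apply]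
  simp
  ring

/-- Testing u = 0 and u = 1 gives Re v = 0, since b > 1. Then Re(v (1 + it)^k) is nonnegative for
small real t and vanishes at t = 0, so its derivative there, -k Im v, is zero as well. -/
theorem eq_zero_of_re_le {v : ℂ} {b : ℝ} {k : ℕ} (hk : 1 ≤ k) (hb : 1 < b)
    (h : ∀ u ∈ Metric.closedBall (1 : ℂ) 1, v.re ≤ b * (v * u ^ k).re) : v = 0 := by
  have h0 : v.re ≤ 0 := by
    simpa [show k ≠ 0 by omega] using h 0 (by simp)
  have h1 : v.re ≤ b * v.re := by simpa using h 1 (by simp)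
  have hre : v.re = 0 := le_antisymm h0 (by nlinarith)
  have hmin : IsLocalMin (fun t : ℝ ↦ (v * (1 + t * Complex.I) ^ k).re) 0 := by
    filter_upwards [Metric.closedBall_mem_nhds (0 : ℝ) one_pos] with t ht
    have h2 := h (1 + t * Complex.I) (by simpa using ht)
    rw [hre] at h2
    simpa [hre] using nonneg_of_mul_nonneg_right h2 (by linarith : 0 < b)
  have hd : HasDerivAt (fun t : ℝ ↦ (v * (1 + t * Complex.I) ^ k).re)
      (v * (k * Complex.I)).re 0 := by
    have h3 : HasDerivAt (fun z : ℂ ↦ v * (1 + z * Complex.I) ^ k) (v * (k * Complex.I))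
        ((0 : ℝ) : ℂ) := by
      have := ((((hasDerivAt_id ((0 : ℝ) : ℂ)).mul_const Complex.I).const_add 1).pow k).const_mul v
      simpa using this
    exact h3.real_of_complex
  have h4 := hmin.hasDerivAt_eq_zero hd
  have h5 : v.im = 0 := by
    have hk' : (k : ℝ) ≠ 0 := by exact_mod_cast (by omega : k ≠ 0)
    simpa [hk'] using h4
  exact Complex.ext hre h5

/-- For functions `1 + p s ^ k` and `1 + b p s ^ k` with `b > 1`, some value of the second on the
disc with centre `s` and radius `|s|` is not larger than the value of the first at `s`. -/
theorem eventually_exists_norm_le {p q : ℂ → ℂ} {κ : ℂ} {b : ℝ} {k : ℕ} (hk : 1 ≤ k)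
    (hb : 1 < b) (hκ : κ ≠ 0) (hp : Tendsto p (𝓝 0) (𝓝 κ)) (hq : Tendsto q (𝓝 0) (𝓝 (b * κ))) :
    ∀ᶠ s in 𝓝[≠] (0 : ℂ), ∃ u ∈ Metric.closedBall (1 : ℂ) 1,
      ‖1 + (u * s) ^ k * q (u * s)‖ ≤ ‖1 + s ^ k * p s‖ := by
  by_contra hcon
  have hfreq : ∃ᶠ s in 𝓝[≠] (0 : ℂ), ∀ u ∈ Metric.closedBall (1 : ℂ) 1,
      ‖1 + s ^ k * p s‖ < ‖1 + (u * s) ^ k * q (u * s)‖ := by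
    refine fun h ↦ hcon (h.mono fun s hs ↦ ?_)
    push Not at hs
    exact hs
  have hne := frequently_iff_neBot.1 hfreq
  -- If the claim failed for s arbitrarily near 0, an ultrafilter on the bad points would have a
  -- limiting direction ω by compactness of the circle. To leading order the failure then reads Re v
  -- ≤ b Re(v u^k) with v = ω^k κ ≠ 0, contradicting `eq_zero_of_re_le`.
  set f := Ultrafilter.of (𝓝[≠] (0 : ℂ) ⊓ 𝓟 {s | ∀ u ∈ Metric.closedBall (1 : ℂ) 1,
      ‖1 + s ^ k * p s‖ < ‖1 + (u * s) ^ k * q (u * s)‖}) with hf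
  have hfle := Ultrafilter.of_le (𝓝[≠] (0 : ℂ) ⊓ 𝓟 {s | ∀ u ∈ Metric.closedBall (1 : ℂ) 1,
      ‖1 + s ^ k * p s‖ < ‖1 + (u * s) ^ k * q (u * s)‖})
  have hf0 : (f : Filter ℂ) ≤ 𝓝 0 := hfle.trans (inf_le_left.trans nhdsWithin_le_nhds)
  have hfne : ∀ᶠ s in (f : Filter ℂ), s ≠ 0 :=
    (hfle.trans inf_le_left) self_mem_nhdsWithin
  have hfbad : ∀ᶠ s in (f : Filter ℂ), ∀ u ∈ Metric.closedBall (1 : ℂ) 1,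
      ‖1 + s ^ k * p s‖ < ‖1 + (u * s) ^ k * q (u * s)‖ :=
    (hfle.trans inf_le_right) (mem_principal_self _)
  have hsph : ∀ᶠ s in (f : Filter ℂ), s / (‖s‖ : ℂ) ∈ Metric.sphere (0 : ℂ) 1 := by
    filter_upwards [hfne] with s hs
    simp [hs]
  obtain ⟨ω, hω, hlim⟩ := (isCompact_sphere (0 : ℂ) 1).ultrafilter_le_nhds
    (f.map fun s ↦ s / (‖s‖ : ℂ)) (le_principal_iff.2 hsph)
  have hω0 : ω ≠ 0 := by
    rintro rfl
    simp at hω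
  have hdir : Tendsto (fun s : ℂ ↦ s / (‖s‖ : ℂ)) f (𝓝 ω) := hlim
  have hρ : Tendsto (fun s : ℂ ↦ ‖s‖ ^ k) f (𝓝 0) := by
    have : Tendsto (fun s : ℂ ↦ ‖s‖ ^ k) (𝓝 0) (𝓝 (‖(0 : ℂ)‖ ^ k)) :=
      (continuous_norm.pow k).tendsto 0
    rw [norm_zero, zero_pow (by omega)] at this
    exact this.mono_left hf0
  have hv := eq_zero_of_re_le (v := ω ^ k * κ) hk hb (fun u hu ↦ ?_)
  · exact mul_ne_zero (pow_ne_zero k hω0) hκ hv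
  · set X : ℂ → ℂ := fun s ↦ (s / (‖s‖ : ℂ)) ^ k * p s with hX
    set Y : ℂ → ℂ := fun s ↦ (s / (‖s‖ : ℂ)) ^ k * (u ^ k * q (u * s)) with hY
    have hXl : Tendsto X f (𝓝 (ω ^ k * κ)) := (hdir.pow k).mul (hp.mono_left hf0)
    have hqu : Tendsto (fun s ↦ q (u * s)) f (𝓝 (b * κ)) := by
      have : Tendsto (fun s : ℂ ↦ u * s) (𝓝 0) (𝓝 0) := by
        simpa using (continuous_const_mul u).tendsto (0 : ℂ)
      exact hq.comp (this.mono_left hf0)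
    have hYl : Tendsto Y f (𝓝 (ω ^ k * (u ^ k * (b * κ)))) :=
      (hdir.pow k).mul (hqu.const_mul _)
    have h1 : Tendsto (fun s ↦ 2 * (X s).re + ‖s‖ ^ k * ‖X s‖ ^ 2) f
        (𝓝 (2 * (ω ^ k * κ).re + 0 * ‖ω ^ k * κ‖ ^ 2)) :=
      ((((Complex.continuous_re.tendsto _).comp hXl).const_mul 2).add
        (hρ.mul (hXl.norm.pow 2)))
    have h2 : Tendsto (fun s ↦ 2 * (Y s).re + ‖s‖ ^ k * ‖Y s‖ ^ 2) f
        (𝓝 (2 * (ω ^ k * (u ^ k * (b * κ))).re + 0 * ‖ω ^ k * (u ^ k * (b * κ))‖ ^ 2)) :=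
      ((((Complex.continuous_re.tendsto _).comp hYl).const_mul 2).add
        (hρ.mul (hYl.norm.pow 2)))
    -- Squaring the strict inequality, subtracting 1 and dividing by ‖s‖^k leaves the first-order
    -- real parts and a remainder that tends to 0.
    have h3 := le_of_tendsto_of_tendsto h1 h2 (by
      filter_upwards [hfne, hfbad] with s hs hbad
      have hs' : 0 < ‖s‖ := norm_pos_iff.2 hs
      have hs'' : ((‖s‖ : ℝ) : ℂ) ≠ 0 := by exact_mod_cast hs'.ne'
      have e1 : s ^ k * p s = ((‖s‖ ^ k : ℝ) : ℂ) * X s := by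
        simp only [hX]; push_cast; rw [div_pow]; field_simp
      have e2 : (u * s) ^ k * q (u * s) = ((‖s‖ ^ k : ℝ) : ℂ) * Y s := by
        simp only [hY]; push_cast; rw [div_pow, mul_pow]; field_simp
      have h4 := hbad u hu
      rw [e1, e2] at h4
      have h5 := pow_lt_pow_left₀ h4 (norm_nonneg _) two_ne_zero
      rw [norm_one_add_mul_sq, norm_one_add_mul_sq] at h5
      have h6 : 0 < ‖s‖ ^ k := by positivity
      exact (lt_of_mul_lt_mul_left (by linarith) h6.le).le)
    have h7 : (ω ^ k * (u ^ k * (b * κ))).re = b * (ω ^ k * κ * u ^ k).re := by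
      rw [show ω ^ k * (u ^ k * (b * κ)) = (b : ℂ) * (ω ^ k * κ * u ^ k) by ring,
        Complex.re_ofReal_mul]
    rw [h7] at h3
    linarith

theorem iteratedDeriv_eventuallyEq {f g : ℂ → ℂ} {a : ℂ} (h : f =ᶠ[𝓝 a] g) (n : ℕ) :
    iteratedDeriv n f =ᶠ[𝓝 a] iteratedDeriv n g := by
  filter_upwards [eventually_eventually_nhds.2 h] with z hz
  exact EventuallyEq.iteratedDeriv_eq n hz

theorem iteratedDeriv_const_mul_sub_pow (c a : ℂ) (n : ℕ) :
    iteratedDeriv n (fun z ↦ c * (z - a) ^ n) = fun _ ↦ n.factorial * c := by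
  induction n generalizing c with
  | zero => ext; simp
  | succ n ih =>
    have : deriv (fun z : ℂ ↦ c * (z - a) ^ (n + 1)) = fun z ↦ (c * (n + 1)) * (z - a) ^ n := by
      ext z
      have h := ((((hasDerivAt_id z).sub_const a).pow (n + 1)).const_mul c).deriv
      refine h.trans ?_
      simp [mul_assoc]
    rw [iteratedDeriv_succ', this, ih]
    ext z
    rw [Nat.factorial_succ]
    push_cast
    ring

/-- One differentiation turns (z - a)^{n+1+k} K into (z - a)^{n+k} ((n+1+k) K + (z - a) K'), whose
cofactor at a is multiplied by n + k + 1. Iterating produces the factor (n + k)!/k! for the leading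
coefficient. -/
theorem exists_iteratedDeriv_sub_pow_mul {K : ℂ → ℂ} {a : ℂ} (hK : AnalyticAt ℂ K a) (n k : ℕ) :
    ∃ L : ℂ → ℂ, AnalyticAt ℂ L a ∧ k.factorial * L a = (n + k).factorial * K a ∧
      iteratedDeriv n (fun z ↦ (z - a) ^ (n + k) * K z) =ᶠ[𝓝 a] fun z ↦ (z - a) ^ k * L z := by
  induction n generalizing K with
  | zero => exact ⟨K, hK, by simp, by simp⟩
  | succ n ih =>
    obtain ⟨L, hL, hLa, hLe⟩ := ih (K := fun z ↦ (n + k + 1) * K z + (z - a) * deriv K z)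
      ((analyticAt_const.mul hK).add ((analyticAt_id.sub analyticAt_const).mul hK.deriv))
    refine ⟨L, hL, ?_, ?_⟩
    · rw [hLa, show n + 1 + k = (n + k) + 1 by ring, Nat.factorial_succ]
      push_cast
      ring
    · rw [iteratedDeriv_succ']
      refine (iteratedDeriv_eventuallyEq ?_ n).trans hLe
      filter_upwards [hK.eventually_analyticAt] with z hz
      have h := ((((hasDerivAt_id z).sub_const a).pow (n + 1 + k)).mul
        hz.differentiableAt.hasDerivAt).deriv
      refine h.trans ?_
      have e1 : n + 1 + k - 1 = n + k := by omega
      have e2 : n + 1 + k = n + k + 1 := by omega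
      simp only [Pi.pow_apply, id, e1]
      rw [e2, pow_succ]
      push_cast
      ring

/-- At a zero of order `n`, the power `|z - a|^n` is bounded by `n! |B z|` over the infimum of
`|B^(n)|` on the disc with centre `z` through `a`. -/
theorem exists_radius_pow_le {B : ℂ → ℂ} {a : ℂ} {n : ℕ} (hn : 1 ≤ n) (hB : AnalyticAt ℂ B a)
    (hord : analyticOrderAt B a = n) :
    ∃ r : ℝ, 0 < r ∧ ∀ z, ‖z - a‖ < r → z ≠ a →
      ‖z - a‖ ^ n ≤ n.factorial / sInf ((fun w ↦ ‖iteratedDeriv n B w‖) ''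
        Metric.closedBall z ‖z - a‖) * ‖B z‖ := by
  obtain ⟨F, hF, hFa, hBF⟩ := hB.analyticOrderAt_eq_natCast.1 hord
  simp only [smul_eq_mul] at hBF
  have hn0 : (n.factorial : ℂ) ≠ 0 := by exact_mod_cast n.factorial_ne_zero
  -- comparison of the quotient with the derivative
  have hcomp : (∃ c : ℝ, 0 < c ∧ ∀ᶠ w in 𝓝 a, c ≤ ‖iteratedDeriv n B w‖) ∧
      ∀ᶠ s in 𝓝[≠] (0 : ℂ), ∃ u ∈ Metric.closedBall (1 : ℂ) 1,
        ‖iteratedDeriv n B (a + u * s)‖ ≤ n.factorial * ‖F (a + s)‖ := by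
    have hmap : ∀ P : ℂ → Prop, (∀ᶠ w in 𝓝 a, P w) → ∃ R > 0, ∀ s : ℂ, ‖s‖ < R → P (a + s) := by
      intro P hP
      obtain ⟨R, hR, h⟩ := Metric.eventually_nhds_iff.1 hP
      exact ⟨R, hR, fun s hs ↦ h (by simpa [dist_eq_norm] using hs)⟩
    have hdisc : ∀ u ∈ Metric.closedBall (1 : ℂ) 1, ∀ s : ℂ, ‖u * s‖ ≤ 2 * ‖s‖ := by
      intro u hu s
      rw [norm_mul]
      gcongr
      rw [mem_closedBall_iff_norm] at hu
      have h1 := norm_add_le (u - 1) 1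
      rw [sub_add_cancel, norm_one] at h1
      linarith
    have hF0 : AnalyticAt ℂ (fun z ↦ F z - F a) a := hF.sub analyticAt_const
    -- When F is locally constant, B^(n) equals n! F(a) near a and u = 1 gives equality.
    by_cases htop : analyticOrderAt (fun z ↦ F z - F a) a = ⊤
    · have hFc := analyticOrderAt_eq_top.1 htop
      have hBc : iteratedDeriv n B =ᶠ[𝓝 a] fun _ ↦ n.factorial * F a := by
        rw [← iteratedDeriv_const_mul_sub_pow (F a) a n]
        apply iteratedDeriv_eventuallyEq
        filter_upwards [hBF, hFc] with z h1 h2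
        rw [h1, sub_eq_zero.1 h2, mul_comm]
      refine ⟨⟨‖(n.factorial : ℂ) * F a‖, norm_pos_iff.2 (mul_ne_zero hn0 hFa), ?_⟩, ?_⟩
      · filter_upwards [hBc] with w hw
        rw [hw]
      · obtain ⟨R, hR, h⟩ := hmap _ (hBc.and hFc)
        filter_upwards [nhdsWithin_le_nhds (Metric.ball_mem_nhds (0 : ℂ) hR)] with s hs
        rw [mem_ball_zero_iff] at hs
        refine ⟨1, by simp, ?_⟩
        rw [one_mul, (h s hs).1, sub_eq_zero.1 (h s hs).2, norm_mul, Complex.norm_natCast]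
    · obtain ⟨k, hk⟩ := ENat.ne_top_iff_exists.1 htop
      obtain ⟨K, hK, hKa, hFK⟩ := hF0.analyticOrderAt_eq_natCast.1 hk.symm
      simp only [smul_eq_mul] at hFK
      have hk1 : 1 ≤ k := by
        rcases Nat.eq_zero_or_pos k with rfl | h
        · have := hFK.self_of_nhds
          simp at this
          exact absurd this.symm hKa
        · exact h
      obtain ⟨L, hL, hLa, hLe⟩ := exists_iteratedDeriv_sub_pow_mul hK n k
      have hBL : iteratedDeriv n B =ᶠ[𝓝 a] fun z ↦ n.factorial * F a + (z - a) ^ k * L z := by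
        have h1 : B =ᶠ[𝓝 a] fun z ↦ F a * (z - a) ^ n + (z - a) ^ (n + k) * K z := by
          filter_upwards [hBF, hFK] with z h2 h3
          rw [h2, ← sub_add_cancel (F z) (F a), h3]
          ring
        refine (iteratedDeriv_eventuallyEq h1 n).trans ?_
        filter_upwards [hLe, hK.eventually_analyticAt] with z hz hKz
        have hd1 : ContDiffAt ℂ n (fun z ↦ F a * (z - a) ^ n) z := by fun_prop
        have hd2 : ContDiffAt ℂ n (fun z ↦ (z - a) ^ (n + k) * K z) z :=
          (ContDiffAt.pow (by fun_prop) _).mul hKz.contDiffAt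
        rw [iteratedDeriv_fun_add hd1 hd2, iteratedDeriv_const_mul_sub_pow, hz]
      have hk0 : (k.factorial : ℂ) ≠ 0 := by exact_mod_cast k.factorial_ne_zero
      -- The ratio of the leading coefficients of B^(n)/n! - F(a) and F - F(a); it exceeds 1 because
      -- n and k are both at least 1.
      set b : ℝ := ((n + k).choose k : ℝ) with hb
      have hb1 : 1 < b := by
        rw [hb]
        have h1 : 1 < (n + k).choose k := by
          have h2 := Nat.choose_le_choose k (show k + 1 ≤ n + k by omega)
          rw [Nat.choose_succ_self_right] at h2
          omega
        exact_mod_cast h1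
      have hLb : L a = b * (n.factorial * K a) := by
        have h1 := Nat.add_choose_mul_factorial_mul_factorial n k
        have h2 : (((n + k).factorial : ℕ) : ℂ) = b * n.factorial * k.factorial := by
          rw [← h1, hb, ← Nat.choose_symm_add]; push_cast; ring
        rw [h2] at hLa
        apply mul_left_cancel₀ hk0
        rw [hLa]; ring
      constructor
      · have hcont : ContinuousAt (fun z ↦ n.factorial * F a + (z - a) ^ k * L z) a := by
          have := hL.continuousAt
          fun_prop
        have hpos : 0 < ‖(n.factorial : ℂ) * F a‖ := norm_pos_iff.2 (mul_ne_zero hn0 hFa)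
        refine ⟨‖(n.factorial : ℂ) * F a‖ / 2, half_pos hpos, ?_⟩
        have h1 : ∀ᶠ w in 𝓝 a, ‖(n.factorial : ℂ) * F a‖ / 2
            < ‖n.factorial * F a + (w - a) ^ k * L w‖ := by
          refine hcont.norm.eventually (lt_mem_nhds ?_)
          simp only [sub_self, zero_pow (by omega : k ≠ 0), zero_mul, add_zero]
          exact half_lt_self hpos
        filter_upwards [h1, hBL] with w h2 h3
        rw [h3]
        exact h2.le
      · obtain ⟨R, hR, h⟩ := hmap _ (hBL.and hFK)
        have hadd : Tendsto (fun s : ℂ ↦ a + s) (𝓝 0) (𝓝 a) := by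
          simpa using (continuous_const_add a).tendsto (0 : ℂ)
        have key := eventually_exists_norm_le (p := fun s ↦ K (a + s) / F a)
          (q := fun s ↦ L (a + s) / (n.factorial * F a)) (κ := K a / F a) hk1 hb1
          (div_ne_zero hKa hFa) ((hK.continuousAt.tendsto.comp hadd).div_const _) (by
            have h1 : (b : ℂ) * (K a / F a) = L a / (n.factorial * F a) := by
              rw [hLb]; field_simp
            rw [h1]
            exact (hL.continuousAt.tendsto.comp hadd).div_const _)
        filter_upwards [key, nhdsWithin_le_nhds (Metric.ball_mem_nhds (0 : ℂ) (half_pos hR))]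
          with s hs hsR
        rw [mem_ball_zero_iff] at hsR
        obtain ⟨u, hu, hle⟩ := hs
        refine ⟨u, hu, ?_⟩
        have hus : ‖u * s‖ < R := (hdisc u hu s).trans_lt (by linarith)
        have e1 : iteratedDeriv n B (a + u * s) = n.factorial * F a *
            (1 + (u * s) ^ k * (L (a + u * s) / (n.factorial * F a))) := by
          rw [(h _ hus).1]
          dsimp only
          rw [add_sub_cancel_left]
          field_simp
        have e2 : F (a + s) = F a * (1 + s ^ k * (K (a + s) / F a)) := by
          have h2 := (h s (by linarith)).2
          rw [add_sub_cancel_left] at h2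
          rw [← sub_add_cancel (F (a + s)) (F a), h2]
          field_simp
          ring
        rw [e1, e2, norm_mul, norm_mul, norm_mul, Complex.norm_natCast, ← mul_assoc]
        gcongr
  obtain ⟨⟨c, hc, hlow⟩, hex⟩ := hcomp
  obtain ⟨R, hR, hRlow⟩ := Metric.eventually_nhds_iff.1 (hlow.and hBF)
  obtain ⟨R', hR', hRex⟩ := Metric.eventually_nhds_iff.1 (eventually_nhdsWithin_iff.1 hex)
  refine ⟨min (R / 2) R', lt_min (half_pos hR) hR', fun z hz hza ↦ ?_⟩
  set I := (fun w ↦ ‖iteratedDeriv n B w‖) '' Metric.closedBall z ‖z - a‖ with hI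
  have hzR : ‖z - a‖ < R / 2 := hz.trans_le (min_le_left _ _)
  have hbdd : BddBelow I := ⟨0, by rintro _ ⟨w, -, rfl⟩; exact norm_nonneg _⟩
  -- The infimum must be positive: with a zero infimum the quotient would be 0 by convention and the
  -- estimate would fail. Radius R/2 keeps the whole disc within R of a.
  have hIc : c ≤ sInf I := by
    apply le_csInf ((Metric.nonempty_closedBall.2 (norm_nonneg _)).image _)
    rintro _ ⟨w, hw, rfl⟩
    refine (hRlow ?_).1
    rw [mem_closedBall_iff_norm] at hw
    rw [dist_eq_norm]
    have := norm_add_le (w - z) (z - a)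
    rw [sub_add_sub_cancel] at this
    linarith
  have hI0 : 0 < sInf I := hc.trans_le hIc
  obtain ⟨u, hu, hle⟩ := hRex (y := z - a) (by simpa using hz.trans_le (min_le_right _ _))
    (by simpa [sub_eq_zero] using hza)
  rw [add_sub_cancel] at hle
  -- The condition |u - 1| ≤ 1 says precisely that a + u(z - a) lies in the disc.
  have hmem : ‖iteratedDeriv n B (a + u * (z - a))‖ ∈ I := by
    refine ⟨_, ?_, rfl⟩
    rw [mem_closedBall_iff_norm] at hu ⊢
    rw [show a + u * (z - a) - z = (u - 1) * (z - a) by ring, norm_mul]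
    exact mul_le_of_le_one_left (norm_nonneg _) hu
  have hinf : sInf I ≤ n.factorial * ‖F z‖ := (csInf_le hbdd hmem).trans hle
  have hBz : ‖B z‖ = ‖z - a‖ ^ n * ‖F z‖ := by
    rw [(hRlow (y := z) (by rw [dist_eq_norm]; linarith [norm_nonneg (z - a)])).2, norm_mul,
      norm_pow]
  rw [hBz, div_mul_eq_mul_div, le_div_iff₀ hI0]
  calc ‖z - a‖ ^ n * sInf I ≤ ‖z - a‖ ^ n * (n.factorial * ‖F z‖) := by gcongr
    _ = _ := by ring

end Zeros

/-! ### Regularization by powers of the sinc function. -/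

section Regularization

theorem norm_csinc_real_mul_le {θ : ℝ} (hθ : 0 < θ) (z : ℂ) :
    ‖csinc (θ * z)‖ ≤ Real.exp (θ * |z.im|) ∧
      ‖z‖ * ‖csinc (θ * z)‖ ≤ Real.exp (θ * |z.im|) / θ := by
  have him : |((θ : ℂ) * z).im| = θ * |z.im| := by
    rw [Complex.im_ofReal_mul, abs_mul, abs_of_pos hθ]
  refine ⟨him ▸ norm_csinc_le (θ * z), ?_⟩
  have h := norm_csinc_mul_le (θ * z)
  rw [him, norm_mul, Complex.norm_real, Real.norm_of_nonneg hθ.le] at h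
  rw [le_div_iff₀ hθ]
  linarith

/-- The truncation error for a function of exponential type `1`, bounded on the real line,
regularized by a power of `sin(θμ)/(θμ)`. -/
theorem exists_regularized_error {θ : ℝ} (hθ : 0 < θ) {m : ℕ} (hm : 2 ≤ m) {g : ℂ → ℂ} {C : ℝ}
    (hg : Differentiable ℂ g) (hb : ∀ z, ‖g z‖ ≤ C * Real.exp |z.im|) :
    ∃ K : ℝ, 0 ≤ K ∧ (∀ (N : ℕ) (μ : ℂ), ‖μ‖ < N * Real.pi / pwType θ m →
      ‖csinc (θ * μ) ^ m * g μ
          - truncCardinal (pwType θ m) N (fun z ↦ csinc (θ * z) ^ m * g z) μ‖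
        ≤ K * ‖Complex.sin (pwType θ m * μ)‖ * errBracket θ m N μ
          * (1 / ((N : ℝ) + 1) ^ (m - 1))) ∧
      ∀ (N : ℕ) (μ : ℂ), ‖csinc (θ * μ) ^ m * g μ
          - truncCardinal (pwType θ m) N (fun z ↦ csinc (θ * z) ^ m * g z) μ‖
        ≤ K * Real.exp (pwType θ m * |μ.im|) := by
  have hC : 0 ≤ C := by simpa using (norm_nonneg _).trans (hb 0)
  have hσ : 0 < pwType θ m := by rw [pwType]; positivity
  have hexp : ∀ t : ℝ, Real.exp (θ * t) ^ m * Real.exp t = Real.exp (pwType θ m * t) := by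
    intro t
    rw [← Real.exp_nat_mul, ← Real.exp_add, pwType]
    ring_nf
  -- This single bound yields both the |x|^{-m} decay on the real axis and the o(e^{σt}) growth on
  -- the imaginary axis.
  have hmul : ∀ z : ℂ, ‖z‖ ^ m * ‖csinc (θ * z) ^ m * g z‖
      ≤ C / θ ^ m * Real.exp (pwType θ m * |z.im|) := by
    intro z
    rw [norm_mul, norm_pow, ← mul_assoc, ← mul_pow, ← hexp]
    calc _ ≤ (Real.exp (θ * |z.im|) / θ) ^ m * (C * Real.exp |z.im|) := by
          gcongr
          · exact (norm_csinc_real_mul_le hθ z).2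
          · exact hb z
      _ = _ := by rw [div_pow]; ring
  refine exists_truncCardinal_error (C := C + C / θ ^ m) hσ hm ?_ (fun z ↦ ?_) (fun x ↦ ?_) ?_
  · exact ((differentiable_csinc.comp (differentiable_id.const_mul _)).pow m).mul hg
  · rw [norm_mul, norm_pow, ← hexp]
    calc _ ≤ Real.exp (θ * |z.im|) ^ m * (C * Real.exp |z.im|) := by
          gcongr
          · exact (norm_csinc_real_mul_le hθ z).1
          · exact hb z
      _ = C * (Real.exp (θ * |z.im|) ^ m * Real.exp |z.im|) := by ring
      _ ≤ _ := by
          gcongr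
          have : 0 ≤ C / θ ^ m := by positivity
          linarith
  · have h := hmul x
    simp only [Complex.norm_real, Real.norm_eq_abs, Complex.ofReal_im, abs_zero, mul_zero,
      Real.exp_zero, mul_one] at h
    linarith
  · have h1 : Tendsto (fun t : ℝ ↦ C / θ ^ m * (t⁻¹) ^ m) atTop (𝓝 0) := by
      have := (tendsto_inv_atTop_zero (𝕜 := ℝ)).pow m
      rw [zero_pow (by omega)] at this
      simpa using this.const_mul (C / θ ^ m)
    refine squeeze_zero' (Eventually.of_forall fun t ↦ by positivity) ?_ h1
    filter_upwards [eventually_gt_atTop 0] with t ht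
    have h := hmul (t * Complex.I)
    have h2 : |((t : ℂ) * Complex.I).im| = t := by simpa using ht.le
    have h3 : ‖(t : ℂ) * Complex.I‖ = t := by simpa using ht.le
    rw [h2, h3] at h
    rw [Real.exp_neg, inv_pow, ← div_eq_mul_inv, ← div_eq_mul_inv,
      div_le_div_iff₀ (Real.exp_pos _) (by positivity)]
    linarith

end Regularization

/-! ### From end values to the characteristic function. -/

section BoundaryDet

theorem boundaryDet_eq (A : Matrix (Fin 2) (Fin 4) ℂ) (Y : Matrix (Fin 2) (Fin 2) ℂ) :
    boundaryDet A Y =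
      (A 0 0 + (A 0 2 * Y 0 0 + A 0 3 * Y 1 0)) * (A 1 1 + (A 1 2 * Y 0 1 + A 1 3 * Y 1 1))
      - (A 0 1 + (A 0 2 * Y 0 1 + A 0 3 * Y 1 1))
        * (A 1 0 + (A 1 2 * Y 0 0 + A 1 3 * Y 1 0)) := by
  rw [boundaryDet, Matrix.det_fin_two]
  simp [Matrix.mul_apply, Fin.sum_univ_four]
  ring

/-- The entries are affine in the end values, and products are compared through ab - a'b' = (a - a')
b + a' (b - b'). -/
theorem norm_boundaryDet_sub_le {A : Matrix (Fin 2) (Fin 4) ℂ} {Y Z : Matrix (Fin 2) (Fin 2) ℂ}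
    {M d : ℝ} (hM : 0 ≤ M) (hA : ∀ i j, ‖A i j‖ ≤ M) (hY : ∀ i j, ‖Y i j‖ ≤ M)
    (hZ : ∀ i j, ‖Z i j‖ ≤ M) (hd : ∀ i j, ‖Y i j - Z i j‖ ≤ d) :
    ‖boundaryDet A Y - boundaryDet A Z‖ ≤ 8 * M * (M + 2 * M ^ 2) * d := by
  have hd0 : 0 ≤ d := (norm_nonneg _).trans (hd 0 0)
  have hent : ∀ (W : Matrix (Fin 2) (Fin 2) ℂ), (∀ i j, ‖W i j‖ ≤ M) → ∀ (i : Fin 2) (p : Fin 4)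
      (l : Fin 2), ‖A i p + (A i 2 * W 0 l + A i 3 * W 1 l)‖ ≤ M + 2 * M ^ 2 := by
    intro W hW i p l
    calc _ ≤ ‖A i p‖ + (‖A i 2‖ * ‖W 0 l‖ + ‖A i 3‖ * ‖W 1 l‖) := by
          rw [← norm_mul, ← norm_mul]
          exact (norm_add_le _ _).trans (add_le_add le_rfl (norm_add_le _ _))
      _ ≤ M + (M * M + M * M) := by gcongr <;> apply_assumption
      _ = _ := by ring
  have hdiff : ∀ (i : Fin 2) (p : Fin 4) (l : Fin 2),
      ‖(A i p + (A i 2 * Y 0 l + A i 3 * Y 1 l)) - (A i p + (A i 2 * Z 0 l + A i 3 * Z 1 l))‖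
        ≤ 2 * M * d := by
    intro i p l
    calc _ = ‖A i 2 * (Y 0 l - Z 0 l) + A i 3 * (Y 1 l - Z 1 l)‖ := by congr 1; ring
      _ ≤ ‖A i 2‖ * ‖Y 0 l - Z 0 l‖ + ‖A i 3‖ * ‖Y 1 l - Z 1 l‖ := by
          rw [← norm_mul, ← norm_mul]; exact norm_add_le _ _
      _ ≤ M * d + M * d := by gcongr <;> apply_assumption
      _ = _ := by ring
  have hprod : ∀ a b a' b' : ℂ, ‖b‖ ≤ M + 2 * M ^ 2 → ‖a'‖ ≤ M + 2 * M ^ 2 →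
      ‖a - a'‖ ≤ 2 * M * d → ‖b - b'‖ ≤ 2 * M * d →
      ‖a * b - a' * b'‖ ≤ 4 * M * (M + 2 * M ^ 2) * d := by
    intro a b a' b' h1 h2 h3 h4
    calc _ = ‖(a - a') * b + a' * (b - b')‖ := by congr 1; ring
      _ ≤ ‖a - a'‖ * ‖b‖ + ‖a'‖ * ‖b - b'‖ := by
          rw [← norm_mul, ← norm_mul]; exact norm_add_le _ _
      _ ≤ 2 * M * d * (M + 2 * M ^ 2) + (M + 2 * M ^ 2) * (2 * M * d) := by gcongr
      _ = _ := by ring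
  rw [boundaryDet_eq, boundaryDet_eq, sub_sub_sub_comm]
  refine (norm_sub_le _ _).trans ?_
  have e1 := hprod _ _ _ _ (hent Y hY 1 1 1) (hent Z hZ 0 0 0) (hdiff 0 0 0) (hdiff 1 1 1)
  have e2 := hprod _ _ _ _ (hent Y hY 1 0 0) (hent Z hZ 0 1 1) (hdiff 0 1 1) (hdiff 1 0 0)
  linarith

end BoundaryDet

section ErrorTerm

variable {θ : ℝ} {m : ℕ}

theorem csinc_real_mul_ne_zero (hθ : 0 < θ) {μ : ℂ}
    (h : ∀ k : ℤ, k ≠ 0 → ((k * Real.pi / θ : ℝ) : ℂ) ≠ μ) : csinc (θ * μ) ≠ 0 := by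
  have hθ' : (θ : ℂ) ≠ 0 := by exact_mod_cast hθ.ne'
  rw [csinc]
  split_ifs with h0
  · exact one_ne_zero
  · refine div_ne_zero (fun hs ↦ ?_) h0
    obtain ⟨k, hk⟩ := Complex.sin_eq_zero_iff.1 hs
    refine h k ?_ ?_
    · rintro rfl
      exact h0 (by simpa using hk)
    · push_cast
      rw [← hk]
      field_simp

theorem errConst_scale_pos (hθ : 0 < θ) (hm : 2 ≤ m) :
    0 < Real.pi * (Real.pi / pwType θ m) ^ (m - 1) * √(1 - (4 : ℝ) ^ (-(m : ℤ) + 1)) := by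
  have hσ : 0 < pwType θ m := by rw [pwType]; positivity
  have hpi := Real.pi_pos
  have h4 : (4 : ℝ) ^ (-(m : ℤ) + 1) < 1 := zpow_lt_one_of_neg₀ (by norm_num) (by omega)
  have : 0 < √(1 - (4 : ℝ) ^ (-(m : ℤ) + 1)) := Real.sqrt_pos.2 (by linarith)
  positivity

theorem errConst_nonneg {β : ℝ} (hθ : 0 < θ) (hm : 2 ≤ m) (hβ : 0 ≤ β) (μ : ℂ) :
    0 ≤ errConst θ m β μ := by
  have := errConst_scale_pos hθ hm
  rw [errConst]
  positivity

theorem errBracket_nonneg (θ : ℝ) (m N : ℕ) (μ : ℂ) : 0 ≤ errBracket θ m N μ := by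
  rw [errBracket]
  positivity

/-- Extraction of the n-th root, distributed over the three factors of the error term. -/
theorem le_rpow_mul_rpow_mul_of_pow_le {s G E T D : ℝ} {N n : ℕ} (hn : 1 ≤ n) (hm : 2 ≤ m)
    (hs : 0 ≤ s) (hG : 0 ≤ G) (hE : 0 ≤ E) (hT : 0 ≤ T)
    (h : s ^ n ≤ G * D) (hDE : D ≤ E * T * (1 / ((N : ℝ) + 1) ^ (m - 1))) :
    s ≤ (G * E) ^ (1 / (n : ℝ)) * T ^ (1 / (n : ℝ))
      * (1 / ((N : ℝ) + 1) ^ (((m : ℝ) - 1) / (n : ℝ))) := by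
  have hN : (0 : ℝ) < (N : ℝ) + 1 := by positivity
  have e1 : 1 / ((N : ℝ) + 1) ^ (((m : ℝ) - 1) / (n : ℝ))
      = (1 / ((N : ℝ) + 1) ^ (m - 1)) ^ (1 / (n : ℝ)) := by
    rw [Real.div_rpow zero_le_one (by positivity), Real.one_rpow, ← Real.rpow_natCast,
      ← Real.rpow_mul hN.le, Nat.cast_sub (by omega), Nat.cast_one, mul_one_div]
  rw [e1, ← Real.mul_rpow (by positivity) hT, ← Real.mul_rpow (by positivity) (by positivity)]
  calc s = (s ^ n) ^ (1 / (n : ℝ)) := by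
        rw [one_div, Real.pow_rpow_inv_natCast hs (by omega)]
    _ ≤ _ := by
        apply Real.rpow_le_rpow (by positivity) _ (by positivity)
        calc s ^ n ≤ G * D := h
          _ ≤ G * (E * T * (1 / ((N : ℝ) + 1) ^ (m - 1))) := by gcongr
          _ = _ := by ring

end ErrorTerm

/-- The functions `g_{kl}` are entire and `O(e^{|Im μ|})`. -/
theorem exists_endValues_bound {q : ℝ → ℂ} (hq : IntervalIntegrable q volume 0 1)
    {yc dyc ys dys : ℂ → ℝ → ℂ} (hc : ∀ μ, IsIVPSolution q μ 1 0 (yc μ) (dyc μ))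
    (hs : ∀ μ, IsIVPSolution q μ 0 1 (ys μ) (dys μ)) :
    (∀ k l, Differentiable ℂ fun μ ↦ endValues yc dyc ys dys μ k l) ∧
    (∀ k l, Differentiable ℂ fun μ ↦ freeValues μ k l) ∧
    ∃ C : ℝ, ∀ k l μ,
      ‖endValues yc dyc ys dys μ k l - freeValues μ k l‖ ≤ C * Real.exp |μ.im| := by
  obtain ⟨c1, c2⟩ := differentiable_end hq hc hc hs
  obtain ⟨s1, s2⟩ := differentiable_end hq hs hc hs
  refine ⟨fun k l ↦ ?_, fun k l ↦ ?_,
    Real.exp (∫ t in (0 : ℝ)..1, ‖q t‖) * (∫ t in (0 : ℝ)..1, ‖q t‖), fun k l μ ↦ ?_⟩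
  · fin_cases k <;> fin_cases l <;> simpa [endValues]
  · have := differentiable_csinc
    fin_cases k <;> fin_cases l <;> simp [freeValues] <;> fun_prop
  · have e1 := (hc μ).norm_end_sub_le hq
    have e2 := (hs μ).norm_end_sub_le hq
    simp only [norm_one, norm_zero, add_zero, zero_add, one_mul, zero_mul, neg_zero] at e1 e2
    fin_cases k <;> fin_cases l <;> simp [endValues, freeValues]
    · exact e1.1
    · exact e2.1
    · simpa using e1.2
    · exact e2.2

/-- The error of the approximate end values, uniformly in the four entries. -/
theorem exists_approxValues_error {θ : ℝ} (hθ : 0 < θ) {m : ℕ} (hm : 2 ≤ m)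
    {Y : ℂ → Matrix (Fin 2) (Fin 2) ℂ} {C : ℝ}
    (hd : ∀ k l, Differentiable ℂ fun μ ↦ Y μ k l - freeValues μ k l)
    (hb : ∀ k l μ, ‖Y μ k l - freeValues μ k l‖ ≤ C * Real.exp |μ.im|) :
    ∃ K : ℝ, 0 ≤ K ∧ ∀ (N : ℕ) (μ : ℂ) (k l : Fin 2), csinc (θ * μ) ≠ 0 →
      (‖μ‖ < N * Real.pi / pwType θ m →
        ‖Y μ k l - approxValues θ m N Y μ k l‖ ≤ (‖csinc (θ * μ)‖ ^ m)⁻¹ *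
          (K * ‖Complex.sin (pwType θ m * μ)‖ * errBracket θ m N μ
            * (1 / ((N : ℝ) + 1) ^ (m - 1)))) ∧
      ‖Y μ k l - approxValues θ m N Y μ k l‖ ≤
        (‖csinc (θ * μ)‖ ^ m)⁻¹ * (K * Real.exp (pwType θ m * |μ.im|)) := by
  choose K hK0 hK1 hK2 using fun k l ↦ exists_regularized_error hθ hm (hd k l) (hb k l)
  have hle : ∀ k l, K k l ≤ ∑ i, ∑ j, K i j := fun k l ↦
    (Finset.single_le_sum (fun j _ ↦ hK0 k j) (Finset.mem_univ l)).trans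
      (Finset.single_le_sum (f := fun i ↦ ∑ j, K i j)
        (fun i _ ↦ Finset.sum_nonneg fun j _ ↦ hK0 i j) (Finset.mem_univ k))
  refine ⟨∑ i, ∑ j, K i j, Finset.sum_nonneg fun i _ ↦ Finset.sum_nonneg fun j _ ↦ hK0 i j,
    fun N μ k l hne ↦ ?_⟩
  have he : Y μ k l - approxValues θ m N Y μ k l = (csinc (θ * μ) ^ m)⁻¹ *
      (csinc (θ * μ) ^ m * (Y μ k l - freeValues μ k l) - truncCardinal (pwType θ m) N
        (fun z ↦ csinc (θ * z) ^ m * (Y z k l - freeValues z k l)) μ) := by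
    have h1 : regularized θ m Y k l
        = fun z ↦ csinc (θ * z) ^ m * (Y z k l - freeValues z k l) := rfl
    rw [approxValues, Matrix.of_apply, h1]
    field_simp
    ring
  have hT := errBracket_nonneg θ m N μ
  rw [he, norm_mul, norm_inv, norm_pow]
  refine ⟨fun hμ ↦ ?_, ?_⟩
  · have h2 := hK1 k l N μ hμ
    have h3 := hle k l
    gcongr
    refine h2.trans ?_
    gcongr
  · have h2 := hK2 k l N μ
    have h3 := hle k l
    gcongr
    refine h2.trans ?_
    gcongr

/-- The error estimate for the approximate characteristic function. -/
theorem exists_charFun_error {q : ℝ → ℂ} (hq : IntervalIntegrable q volume 0 1)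
    {A : ℂ → Matrix (Fin 2) (Fin 4) ℂ} {yc dyc ys dys : ℂ → ℝ → ℂ}
    (hc : ∀ μ, IsIVPSolution q μ 1 0 (yc μ) (dyc μ))
    (hs : ∀ μ, IsIVPSolution q μ 0 1 (ys μ) (dys μ)) {θ : ℝ} (hθ : 0 < θ) {m : ℕ} (hm : 2 ≤ m)
    {S : Set ℂ} (hS : Bornology.IsBounded S)
    (hSθ : ∀ k : ℤ, k ≠ 0 → ((k * Real.pi / θ : ℝ) : ℂ) ∉ closure S)
    (hSA : ∃ M : ℝ, ∀ μ ∈ S, ∀ i j, ‖A μ i j‖ ≤ M) :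
    ∃ β : ℝ, 0 < β ∧ ∀ (N : ℕ) (μ : ℂ), μ ∈ S → ‖μ‖ < N * Real.pi / pwType θ m →
      ‖charFun A (endValues yc dyc ys dys) μ
          - approxCharFun A (endValues yc dyc ys dys) θ m N μ‖ ≤
        errConst θ m β μ * errBracket θ m N μ * (1 / ((N : ℝ) + 1) ^ (m - 1)) := by
  obtain ⟨hYd, hFd, C, hC⟩ := exists_endValues_bound hq hc hs
  set Y := endValues yc dyc ys dys with hY
  obtain ⟨K, hK0, hK⟩ := exists_approxValues_error hθ hm (fun k l ↦ (hYd k l).sub (hFd k l)) hC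
  have hσ : 0 < pwType θ m := by rw [pwType]; positivity
  have hcpt : IsCompact (closure S) := hS.isCompact_closure
  have hne : ∀ μ ∈ closure S, csinc (θ * μ) ≠ 0 := fun μ hμ ↦
    csinc_real_mul_ne_zero hθ fun k hk h ↦ hSθ k hk (h ▸ hμ)
  -- The crude truncation bound keeps the approximate end values bounded on S uniformly in N, as the
  -- Lipschitz estimate for the determinant requires.
  obtain ⟨M₁, hM₁⟩ : ∃ M, ∀ μ ∈ closure S,
      (‖csinc (θ * μ)‖ ^ m)⁻¹ * (K * Real.exp (pwType θ m * |μ.im|)) ≤ M := by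
    have hcont : ContinuousOn
        (fun μ ↦ (‖csinc (θ * μ)‖ ^ m)⁻¹ * (K * Real.exp (pwType θ m * |μ.im|))) (closure S) := by
      have h1 : Continuous fun μ : ℂ ↦ csinc (θ * μ) :=
        differentiable_csinc.continuous.comp (continuous_const_mul _)
      refine ContinuousOn.mul (ContinuousOn.inv₀ (h1.norm.pow m).continuousOn fun μ hμ ↦ ?_)
        (Continuous.continuousOn (by fun_prop))
      exact pow_ne_zero m (norm_ne_zero_iff.2 (hne μ hμ))
    obtain ⟨M, hM⟩ := hcpt.bddAbove_image hcont
    exact ⟨M, fun μ hμ ↦ hM ⟨μ, hμ, rfl⟩⟩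
  obtain ⟨M₂, hM₂⟩ : ∃ M, ∀ k l, ∀ μ ∈ closure S, ‖Y μ k l‖ ≤ M := by
    choose M hM using fun k l ↦ hcpt.exists_bound_of_continuousOn (hYd k l).continuous.continuousOn
    refine ⟨∑ i, ∑ j, |M i j|, fun k l μ hμ ↦ ?_⟩
    exact (hM k l μ hμ).trans ((le_abs_self _).trans
      ((Finset.single_le_sum (f := fun j ↦ |M k j|) (fun j _ ↦ abs_nonneg _)
        (Finset.mem_univ l)).trans (Finset.single_le_sum (f := fun i ↦ ∑ j, |M i j|)
          (fun i _ ↦ Finset.sum_nonneg fun j _ ↦ abs_nonneg _) (Finset.mem_univ k))))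
  obtain ⟨M₃, hM₃⟩ := hSA
  set M := |M₁| + |M₂| + |M₃| with hM
  have hM0 : 0 ≤ M := by positivity
  set W := Real.pi * (Real.pi / pwType θ m) ^ (m - 1) * √(1 - (4 : ℝ) ^ (-(m : ℤ) + 1)) with hW
  have hW0 : 0 < W := errConst_scale_pos hθ hm
  set Λ := 8 * M * (M + 2 * M ^ 2) with hΛ
  have hΛ0 : 0 ≤ Λ := by positivity
  -- The factor W cancels the denominator built into `errConst`; the summand 1 only ensures
  -- positivity.
  refine ⟨Λ * K * W + 1, by positivity, fun N μ hμ hμN ↦ ?_⟩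
  have hμ' := subset_closure hμ
  have hT := errBracket_nonneg θ m N μ
  have hAM : ∀ i j, ‖A μ i j‖ ≤ M := fun i j ↦ (hM₃ μ hμ i j).trans (by
    linarith [le_abs_self M₃, abs_nonneg M₁, abs_nonneg M₂])
  have hYM : ∀ i j, ‖Y μ i j‖ ≤ M := fun i j ↦ (hM₂ i j μ hμ').trans (by
    linarith [le_abs_self M₂, abs_nonneg M₁, abs_nonneg M₃])
  have hZM : ∀ i j, ‖approxValues θ m N Y μ i j‖ ≤ M := by
    intro i j
    have h1 := ((hK N μ i j (hne μ hμ')).2).trans (hM₁ μ hμ')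
    have h2 := hM₂ i j μ hμ'
    have h3 : approxValues θ m N Y μ i j = Y μ i j - (Y μ i j - approxValues θ m N Y μ i j) := by
      ring
    rw [h3]
    refine (norm_sub_le _ _).trans ?_
    linarith [le_abs_self M₁, le_abs_self M₂, abs_nonneg M₃]
  have hdet := norm_boundaryDet_sub_le hM0 hAM hYM hZM fun i j ↦ (hK N μ i j (hne μ hμ')).1 hμN
  refine hdet.trans ?_
  rw [← hΛ, errConst, zpow_neg, zpow_natCast, ← hW]
  have h4 : Λ * K * ‖Complex.sin (pwType θ m * μ)‖
      ≤ ‖Complex.sin (pwType θ m * μ)‖ * (Λ * K * W + 1) / W := by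
    rw [le_div_iff₀ hW0]
    linarith [norm_nonneg (Complex.sin (pwType θ m * μ))]
  calc _ = (‖csinc (θ * μ)‖ ^ m)⁻¹ * (Λ * K * ‖Complex.sin (pwType θ m * μ)‖)
        * errBracket θ m N μ * (1 / ((N : ℝ) + 1) ^ (m - 1)) := by ring
    _ ≤ _ := by gcongr

end RegularizedSampling

/-! ### The theorem. -/

open RegularizedSampling in
theorem theorem2p7
    (q : ℝ → ℂ) (hq : IntervalIntegrable q volume 0 1)
    (A : ℂ → Matrix (Fin 2) (Fin 4) ℂ) (hA : ∀ μ, (A μ).rank = 2)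
    (yc dyc ys dys : ℂ → ℝ → ℂ)
    (hc : ∀ μ, IsIVPSolution q μ 1 0 (yc μ) (dyc μ))
    (hs : ∀ μ, IsIVPSolution q μ 0 1 (ys μ) (dys μ))
    (B : ℂ → ℂ) (hB : B = charFun A (endValues yc dyc ys dys))
    (θ : ℝ) (hθ : 0 < θ) (m : ℕ) (hm : 2 ≤ m)
    (BN : ℕ → ℂ → ℂ)
    (hBN : ∀ N, BN N = approxCharFun A (endValues yc dyc ys dys) θ m N)
    -- the region of the plane on which the constant is uniform
    (S : Set ℂ) (hS : Bornology.IsBounded S)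
    (hSθ : ∀ k : ℤ, k ≠ 0 → ((k * Real.pi / θ : ℝ) : ℂ) ∉ closure S)
    (hSA : ∃ M : ℝ, ∀ μ ∈ S, ∀ i j, ‖A μ i j‖ ≤ M) :
    ∃ β₄ : ℝ, 0 < β₄ ∧
      -- `β₄` is a constant in the error estimate for `B_N`
      (∀ (N : ℕ) (μ : ℂ), μ ∈ S → ‖μ‖ < N * Real.pi / pwType θ m →
        ‖B μ - BN N μ‖ ≤
          errConst θ m β₄ μ * errBracket θ m N μ * (1 / ((N : ℝ) + 1) ^ (m - 1))) ∧
      -- the estimate for the zeros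
      (∀ (n : ℕ) (μbar : ℂ), 1 ≤ n → AnalyticAt ℂ B μbar →
        analyticOrderAt B μbar = (n : ℕ∞) →
        ∃ r : ℝ, 0 < r ∧
          ∀ (N : ℕ) (μN : ℂ), μN ∈ S → ‖μN - μbar‖ < r → BN N μN = 0 →
            ‖μN‖ < N * Real.pi / pwType θ m →
            (∀ k : ℤ, k ≠ 0 →
              ((k * Real.pi / θ : ℝ) : ℂ) ∉ Metric.closedBall μN ‖μN - μbar‖) →
            ‖μN - μbar‖ ≤
              ((n.factorial : ℝ) /
                  sInf ((fun z => ‖iteratedDeriv n B z‖) ''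
                    Metric.closedBall μN ‖μN - μbar‖)
                * errConst θ m β₄ μN) ^ (1 / (n : ℝ))
              * errBracket θ m N μN ^ (1 / (n : ℝ))
              * (1 / ((N : ℝ) + 1) ^ (((m : ℝ) - 1) / (n : ℝ)))) := by
  obtain ⟨β, hβ, herr⟩ := exists_charFun_error hq hc hs hθ hm hS hSθ hSA
  have herr' : ∀ (N : ℕ) (μ : ℂ), μ ∈ S → ‖μ‖ < N * Real.pi / pwType θ m →
      ‖B μ - BN N μ‖ ≤
        errConst θ m β μ * errBracket θ m N μ * (1 / ((N : ℝ) + 1) ^ (m - 1)) := by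
    intro N μ hμ hμN
    rw [hB, hBN]
    exact herr N μ hμ hμN
  refine ⟨β, hβ, herr', fun n μbar hn hBa hord ↦ ?_⟩
  obtain ⟨r, hr, hrad⟩ := exists_radius_pow_le hn hBa hord
  refine ⟨r, hr, fun N μN hμS hμr hzero hμN _ ↦ ?_⟩
  have hE := errConst_nonneg hθ hm hβ.le μN
  have hT := errBracket_nonneg θ m N μN
  have hG : 0 ≤ (n.factorial : ℝ) / sInf ((fun z => ‖iteratedDeriv n B z‖) ''
      Metric.closedBall μN ‖μN - μbar‖) := by
    refine div_nonneg (Nat.cast_nonneg _) (Real.sInf_nonneg ?_)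
    rintro _ ⟨w, -, rfl⟩
    exact norm_nonneg _
  -- The radius estimate concerns z ≠ a; when the two zeros coincide the left-hand side is 0 and the
  -- right-hand side is nonnegative.
  by_cases hne : μN = μbar
  · have h0 : ‖μN - μbar‖ = 0 := by rw [hne, sub_self, norm_zero]
    refine h0.le.trans (mul_nonneg (mul_nonneg (Real.rpow_nonneg (mul_nonneg hG hE) _)
      (Real.rpow_nonneg hT _)) ?_)
    positivity
  -- Since B_N vanishes at μN, the approximation error there is |B(μN)| itself.
  · have hD := herr' N μN hμS hμN
    rw [hzero, sub_zero] at hD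
    exact le_rpow_mul_rpow_mul_of_pow_le hn hm (norm_nonneg _) hG hE hT (hrad μN hμr hne) hD
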